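/- **Setting.** Let $n\ge 2$ and let $r:\mathbb C^n\to\mathbb R$ be smooth and convex, such that $\Omega=\{r<0\}$ is non-empty, bounded and of finite type $M$ (the supremum over $p\in b\Omega$ of the maximal order of contact of $\{r=0\}$ at $p$ with germs of non-singular complex analytic sets is $M<\infty$), and $|\nabla r|=1$ on $b\Omega$. *Quasi-metric.* For $\xi,u\in\mathbb C^n$ and $\varepsilon>0$ let $\tau(\xi,u,\varepsilon)=\sup\{c>0: |r(\xi+\lambda u)-r(\xi)|\le\varepsilon \text{ for all } \lambda\in\mathbb C,\ |\lambda|\le c\}$. An $\varepsilon$-extremal basis at $\xi\in b\Omega$ is a (complex) orthonormal basis $u_1,\dots,u_n$ of $\mathbb C^n$ such that $u_1$ is the direction of $q_1-\xi$, where $q_1=\xi+s\nabla r(\xi)$, $s>0$, $r(q_1)=r(\xi)+\varepsilon$, and such that for $k\ge2$ the vector $u_k$ maximizes, among the unit vectors $u$ orthogonal to $u_1,\dots,u_{k-1}$, the distance from $\xi$ to $\{r=r(\xi)+\varepsilon\}$ along the complex line $\xi+\mathbb C u$. Fix a choice of such a basis for all $\xi\in b\Omega$, $\varepsilon>0$,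 and let $P_\varepsilon(\xi)=\{\xi+\sum_k\lambda_ku_k: |\lambda_k|\le\tau(\xi,u_k,\varepsilon)\}$, $\rho(\zeta_1,\zeta_2)=\inf\{\varepsilon>0:\zeta_1\in P_\varepsilon(\zeta_2),\ \zeta_2\in P_\varepsilon(\zeta_1)\}$ and $B(\zeta,\varepsilon)=\{\eta\in b\Omega:\rho(\eta,\zeta)<\varepsilon\}$. Let $\sigma$ be the surface measure on $b\Omega$. *Dyadic decompositions.* A dyadic decomposition of $b\Omega$ consists of constants $\mathfrak C>0$, $0<\delta,\epsilon<1$ and families $\mathcal D_k$, $k\ge1$, of Borel subsets of $b\Omega$ (cubes; those in $\mathcal D_k$ have sidelength $\ell(Q)=\delta^k$), with centers $c(Q)\in b\Omega$, such that: (1) $b\Omega=\bigcup_{Q\in\mathcal D_k}Q$ for every $k\ge 1$; (2) of any two cubes that intersect, one contains the other; (3) every $Q\in\mathcal D_k$ contains some $Q'\in\mathcal D_{k+1}$; (4) every $Q\in\mathcal D_{k+1}$ is contained in exactly one element of $\mathcal D_k$; (5) if $Q_1\in\mathcal D_k$, $Q_2\in\mathcal D_{k+1}$, $Q_2\subseteq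 Q_1$, then $\sigma(Q_2)\ge\epsilon\,\sigma(Q_1)$; (6) $B(c(Q),\delta^k)\subseteq Q\subseteq B(c(Q),\mathfrak C\delta^k)$ for $Q\in\mathcal D_k$. *Flow tents.* Let $V\subseteq U$ be open neighborhoods of $b\Omega$ and $t_0>0$ such that $\frac23\le|\nabla r|\le\frac32$ on $U$ and the flow of $-\nabla r/|\nabla r|^2$ from each point of $V$ exists in $U$ for the times in $[0,t_0)$. Let $\Pi^{flow}(z)$ be the point of $b\Omega$ that flows, within $U$, into $z$ at time $-r(z)$. For a dyadic decomposition choose $N_0\ge1$ with $\delta^{N_0}<t_0$ and $\{-\delta^{N_0}<r<0\}\subseteq V$, and let $\mathcal D$ be the collection that consists of $\Omega$ and of the dyadic flow tents $$T^{flow}_d(Q)=\{z\in V:\ \Pi^{flow}(z)\in Q,\ -\delta^k<r(z)<0\},\qquad Q\in\mathcal D_k,\ k\ge N_0 .$$ *Muckenhoupt bases.* A basis $\mathcal B$ of $\Omega$ is a collection of measurable subsets of $\Omega$ of positive volume. Write $\langle f\rangle_B=\frac1{\mathrm{Vol}(B)}\int_B|f|\,dV$ and $M_{\mathcal B}f(z)=\sup_{z\in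 B\in\mathcal B}\langle f\rangle_B$. For $1<p<\infty$, $\frac1p+\frac1{p'}=1$, a measurable $w:\Omega\to[0,\infty)$ belongs to $A_{p,\mathcal B}$ if $[w]_{A_{p,\mathcal B}}=\sup_{B\in\mathcal B}\langle w\rangle_B\langle w^{1-p'}\rangle_B^{p-1}<\infty$ (with values in $[0,\infty]$, $0^{1-p'}=\infty$ and $0\cdot\infty=0$). $\mathcal B$ is a Muckenhoupt basis if for all $1<p<\infty$, $K<\infty$, every $w\in A_{p,\mathcal B}$ with $[w]_{A_{p,\mathcal B}}\le K$ and every measurable $f:\Omega\to\mathbb C$, the function $M_{\mathcal B}f$ is measurable and $$\int_\Omega (M_{\mathcal B}f)^p\,w\,dV\le C(p,K)\int_\Omega|f|^p\,w\,dV .$$ **Proposition.** (a) Each collection $\mathcal D$ as above is a Muckenhoupt basis of $\Omega$, with constants $C(p,K)$ that depend only on $p$, $K$, $r$ and $n$. (b) For every $K_0$ and all such collections $\mathcal D^1,\dots,\mathcal D^{K_0}$ (with the same $U,V,t_0$ and the same extremal bases), $\mathcal G=\bigcup_{i=1}^{K_0}\mathcal D^i$ is a Muckenhoupt basis of $\Omega$,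 with constants $C(p,K)$ that depend only on $p$, $K$, $r$, $n$ and $K_0$. -/

import Mathlib

open MeasureTheory Set
open scoped ENNReal NNReal ContDiff

noncomputable section

namespace FlowTents

/-- `ℂⁿ` with its Euclidean norm; its `volume` is Lebesgue measure on `ℝ²ⁿ`. -/
abbrev Cn (n : ℕ) : Type := EuclideanSpace ℂ (Fin n)

variable {n : ℕ}

/-! ### The domain -/

/-- The domain `Ω = {r < 0}`. -/
def domain (r : Cn n → ℝ) : Set (Cn n) := {z | r z < 0}

/-- The boundary `bΩ`. -/
def bdry (r : Cn n → ℝ) : Set (Cn n) := frontier (domain r)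

/-- The orders of contact at `p` of `{r = 0}` with germs of non-singular holomorphic curves.
(A non-singular analytic germ of higher dimension contains non-singular curves, whose order of
contact is at least as large, so that curves give the same supremum.) -/
def contactOrders (r : Cn n → ℝ) (p : Cn n) : Set ℕ :=
  {m | ∃ γ : ℂ → Cn n, AnalyticAt ℂ γ 0 ∧ γ 0 = p ∧ deriv γ 0 ≠ 0 ∧
    (fun ζ : ℂ => r (γ ζ)) =O[nhds 0] (fun ζ : ℂ => ‖ζ‖ ^ m)}

/-- The type of the boundary point `p`. -/
def pointType (r : Cn n → ℝ) (p : Cn n) : ℕ∞ := ⨆ m ∈ contactOrders r p, (m : ℕ∞)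

/-- `r` is a smooth, everywhere convex defining function, normalized by `|∇r| = 1` on `bΩ`, of a
bounded (non-empty, convex) domain of finite type `M`. -/
structure IsDefiningFunction (r : Cn n → ℝ) (M : ℕ) : Prop where
  smooth : ContDiff ℝ ∞ r
  convex : ConvexOn ℝ univ r
  nonempty : (domain r).Nonempty
  bounded : Bornology.IsBounded (domain r)
  norm_gradient : ∀ z ∈ bdry r, ‖gradient r z‖ = 1
  type_eq : ⨆ p ∈ bdry r, pointType r p = (M : ℕ∞)

/-! ### McNeal-Stein tents and the quasi-metric on the boundary -/

/-- `τ(ξ, u, ε)`, the supremum of the `c` with `|r (ξ + λ u) - r ξ| ≤ ε` for all complex `λ`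
with `|λ| ≤ c`. -/
def tau (r : Cn n → ℝ) (ξ u : Cn n) (ε : ℝ) : ℝ≥0∞ :=
  ⨆ c ∈ {c : ℝ≥0 | ∀ l : ℂ, ‖l‖ ≤ c → |r (ξ + l • u) - r ξ| ≤ ε}, (c : ℝ≥0∞)

/-- The distance from `ξ` to the level set `{r = r ξ + ε}` along the complex line `ξ + ℂ u`. -/
def levelDist (r : Cn n → ℝ) (ξ u : Cn n) (ε : ℝ) : ℝ :=
  Metric.infDist ξ {z | r z = r ξ + ε ∧ ∃ l : ℂ, z = ξ + l • u}

/-- `b` is an `ε`-extremal basis at `ξ`: its first vector is the direction in which the line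
through `ξ` along the gradient reaches `{r = r ξ + ε}`, and each further vector maximizes the
distance to this level set among the unit vectors orthogonal (over `ℂ`) to the preceding ones. -/
def IsExtremalBasis (r : Cn n → ℝ) (ξ : Cn n) (ε : ℝ)
    (b : OrthonormalBasis (Fin n) ℂ (Cn n)) : Prop :=
  (∀ i : Fin n, i.val = 0 → ∃ s : ℝ, 0 < s ∧ r (ξ + s • gradient r ξ) = r ξ + ε ∧
    b i = ‖s • gradient r ξ‖⁻¹ • (s • gradient r ξ)) ∧
  (∀ i : Fin n, 0 < i.val → ∀ v : Cn n, ‖v‖ = 1 → (∀ j < i, inner ℂ (b j) v = 0) →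
    levelDist r ξ v ε ≤ levelDist r ξ (b i) ε)

/-- A choice of bases, one for each point and each scale. -/
abbrev BasisChoice (n : ℕ) : Type := Cn n → ℝ → OrthonormalBasis (Fin n) ℂ (Cn n)

/-- The chosen basis is extremal at every boundary point and every scale. -/
def IsExtremalChoice (r : Cn n → ℝ) (e : BasisChoice n) : Prop :=
  ∀ ξ ∈ bdry r, ∀ ε : ℝ, 0 < ε → IsExtremalBasis r ξ ε (e ξ ε)

/-- The polydisc `P_ε(ξ)`. -/
def polydisc (r : Cn n → ℝ) (e : BasisChoice n) (ξ : Cn n) (ε : ℝ) : Set (Cn n) :=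
  {z | ∀ k, ‖(e ξ ε).repr (z - ξ) k‖ₑ ≤ tau r ξ (e ξ ε k) ε}

/-- The quasi-metric `ρ` on `bΩ`. -/
def rho (r : Cn n → ℝ) (e : BasisChoice n) (ζ₁ ζ₂ : Cn n) : ℝ :=
  sInf {ε : ℝ | 0 < ε ∧ ζ₁ ∈ polydisc r e ζ₂ ε ∧ ζ₂ ∈ polydisc r e ζ₁ ε}

/-- The ball `B(ζ, ε)` in `bΩ`. -/
def qball (r : Cn n → ℝ) (e : BasisChoice n) (ζ : Cn n) (ε : ℝ) : Set (Cn n) :=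
  {η | η ∈ bdry r ∧ rho r e η ζ < ε}

/-- The surface measure `σ`, i.e. the Euclidean `(2n-1)`-dimensional measure, used on subsets of
`bΩ`. -/
def surf (n : ℕ) : Measure (Cn n) := Measure.euclideanHausdorffMeasure (2 * n - 1)

/-! ### Dyadic decompositions of the boundary -/

/-- A dyadic decomposition of `bΩ`: generations `cubes k`, `k ≥ 1`, of Borel sets with centers
`center k Q` and sidelength `δ ^ k`. -/
structure DyadicGrid (r : Cn n → ℝ) (e : BasisChoice n) where
  cubes : ℕ → Set (Set (Cn n))
  center : ℕ → Set (Cn n) → Cn n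
  bigC : ℝ
  δ : ℝ
  ϵ : ℝ
  bigC_pos : 0 < bigC
  δ_pos : 0 < δ
  δ_lt_one : δ < 1
  ϵ_pos : 0 < ϵ
  ϵ_lt_one : ϵ < 1
  measurable : ∀ k, 1 ≤ k → ∀ Q ∈ cubes k, MeasurableSet Q
  cover : ∀ k, 1 ≤ k → ⋃₀ cubes k = bdry r
  nested : ∀ k l, 1 ≤ k → 1 ≤ l → ∀ Q₁ ∈ cubes k, ∀ Q₂ ∈ cubes l,
    (Q₁ ∩ Q₂).Nonempty → Q₁ ⊆ Q₂ ∨ Q₂ ⊆ Q₁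
  exists_child : ∀ k, 1 ≤ k → ∀ Q ∈ cubes k, ∃ Q' ∈ cubes (k + 1), Q' ⊆ Q
  exists_unique_parent : ∀ k, 1 ≤ k → ∀ Q ∈ cubes (k + 1), ∃! P, P ∈ cubes k ∧ Q ⊆ P
  child_measure : ∀ k, 1 ≤ k → ∀ Q₁ ∈ cubes k, ∀ Q₂ ∈ cubes (k + 1), Q₂ ⊆ Q₁ →
    ENNReal.ofReal ϵ * surf n Q₁ ≤ surf n Q₂
  center_mem : ∀ k, 1 ≤ k → ∀ Q ∈ cubes k, center k Q ∈ bdry r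
  sandwich : ∀ k, 1 ≤ k → ∀ Q ∈ cubes k,
    qball r e (center k Q) (δ ^ k) ⊆ Q ∧ Q ⊆ qball r e (center k Q) (bigC * δ ^ k)

/-! ### The normal gradient flow and the dyadic flow tents -/

/-- The vector field `-∇r / |∇r|²`. -/
def normalField (r : Cn n → ℝ) (z : Cn n) : Cn n := -((‖gradient r z‖ ^ 2)⁻¹ • gradient r z)

/-- `γ` is an integral curve in `U`, on the time set `I`, of `-∇r / |∇r|²`, starting at `x`. -/
def IsFlowLine (r : Cn n → ℝ) (U : Set (Cn n)) (I : Set ℝ) (x : Cn n) (γ : ℝ → Cn n) : Prop :=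
  γ 0 = x ∧ ∀ t ∈ I, γ t ∈ U ∧ HasDerivWithinAt γ (normalField r (γ t)) I t

/-- `U` is a neighborhood of `bΩ` with `2/3 ≤ |∇r| ≤ 3/2`, and `V ⊆ U` is a neighborhood of `bΩ`
such that the flow starting at points of `V` exists in `U` for all times in `[0, t₀)`. -/
structure IsFlowNeighborhood (r : Cn n → ℝ) (U V : Set (Cn n)) (t₀ : ℝ) : Prop where
  isOpen_U : IsOpen U
  isOpen_V : IsOpen V
  bdry_subset : bdry r ⊆ V
  subset : V ⊆ U
  gradient_bounds : ∀ z ∈ U, 2 / 3 ≤ ‖gradient r z‖ ∧ ‖gradient r z‖ ≤ 3 / 2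
  t₀_pos : 0 < t₀
  flow : ∀ x ∈ V, ∃ γ : ℝ → Cn n, IsFlowLine r U (Ico 0 t₀) x γ

/-- `x ∈ bΩ` flows into `z` at the time `-r z`. -/
def FlowsTo (r : Cn n → ℝ) (U : Set (Cn n)) (x z : Cn n) : Prop :=
  x ∈ bdry r ∧ ∃ γ : ℝ → Cn n, IsFlowLine r U (Icc 0 (-r z)) x γ ∧ γ (-r z) = z

open Classical in
/-- The projection `Π^flow` to the boundary along the flow lines: the (unique) boundary point that
flows into `z` at the time `-r z`. (If there is none, the value is `z`.) -/
def flowProj (r : Cn n → ℝ) (U : Set (Cn n)) (z : Cn n) : Cn n :=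
  if h : ∃ x, FlowsTo r U x z then h.choose else z

/-- The dyadic flow tent over `Q`, where `Q` has sidelength `l`. -/
def flowTent (r : Cn n → ℝ) (U V : Set (Cn n)) (Q : Set (Cn n)) (l : ℝ) : Set (Cn n) :=
  {z | z ∈ V ∧ flowProj r U z ∈ Q ∧ r z ∈ Ioo (-l) 0}

/-- `N₀` is an admissible first generation: the flow reaches all levels up to depth `δ ^ N₀`, and
the part of `Ω` above this depth lies in `V`. -/
def IsAdmissible (r : Cn n → ℝ) (V : Set (Cn n)) (t₀ δ : ℝ) (N₀ : ℕ) : Prop :=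
  1 ≤ N₀ ∧ δ ^ N₀ < t₀ ∧ domain r \ {z | r z ≤ -δ ^ N₀} ⊆ V

/-- The collection of the dyadic flow tents over the cubes of the generations `k ≥ N₀`, together
with `Ω`, the tent over `bΩ`. -/
def tents (r : Cn n → ℝ) (U V : Set (Cn n)) {e : BasisChoice n} (D : DyadicGrid r e) (N₀ : ℕ) :
    Set (Set (Cn n)) :=
  {domain r} ∪ {T | ∃ k, N₀ ≤ k ∧ ∃ Q ∈ D.cubes k, T = flowTent r U V Q (D.δ ^ k)}

/-! ### Muckenhoupt bases -/

/-- The average of a non-negative function over `B`. -/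
def avg (B : Set (Cn n)) (g : Cn n → ℝ≥0∞) : ℝ≥0∞ := (volume B)⁻¹ * ∫⁻ z in B, g z

/-- The maximal operator `M_𝓑`. (It vanishes off the union of `𝓑`.) -/
def maximalOp (𝓑 : Set (Set (Cn n))) (f : Cn n → ℂ) (z : Cn n) : ℝ≥0∞ :=
  ⨆ B ∈ {B | B ∈ 𝓑 ∧ z ∈ B}, avg B (fun y => ‖f y‖ₑ)

/-- A basis of `Ω`: a collection of measurable subsets of `Ω` of positive volume. -/
def IsBasis (Ω : Set (Cn n)) (𝓑 : Set (Set (Cn n))) : Prop :=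
  ∀ B ∈ 𝓑, MeasurableSet B ∧ B ⊆ Ω ∧ 0 < volume B

/-- The weight `w` belongs to `A_{p,𝓑}` with `[w]_{A_{p,𝓑}} ≤ K`. Powers and products are taken
in `[0, ∞]`, so that `w ^ (1 - p')` is `∞` where `w` vanishes. -/
def ApBound (𝓑 : Set (Set (Cn n))) (p : ℝ) (w : Cn n → ℝ≥0) (K : ℝ≥0) : Prop :=
  ∀ B ∈ 𝓑, avg B (fun z => (w z : ℝ≥0∞)) *
    avg B (fun z => (w z : ℝ≥0∞) ^ (1 - p.conjExponent)) ^ (p - 1) ≤ K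

/-- `𝓑` is a Muckenhoupt basis of `Ω` with bound `C p K` for the `p`-th power of the norm of `M_𝓑`
on `L^p(w)` when `[w]_{A_{p,𝓑}} ≤ K`. -/
def IsMuckenhouptBasis (Ω : Set (Cn n)) (𝓑 : Set (Set (Cn n))) (C : ℝ → ℝ≥0 → ℝ≥0) : Prop :=
  IsBasis Ω 𝓑 ∧
  ∀ p : ℝ, 1 < p → ∀ w : Cn n → ℝ≥0, AEMeasurable w (volume.restrict Ω) →
    ∀ K : ℝ≥0, ApBound 𝓑 p w K →
      ∀ f : Cn n → ℂ, AEMeasurable f (volume.restrict Ω) →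
        AEMeasurable (maximalOp 𝓑 f) (volume.restrict Ω) ∧
        ∫⁻ z in Ω, maximalOp 𝓑 f z ^ p * w z ≤ C p K * ∫⁻ z in Ω, ‖f z‖ₑ ^ p * w z

end FlowTents

end

noncomputable section

namespace FlowTents

variable {n : ℕ}

/-! The tents inherit nestedness from the cubes: two tents that share a point `z` lie over cubes
that share the projection of `z`, so the tent of the later generation lies in the other. The theorem
thus reduces to a weighted maximal inequality for a countable nested family containing Ω, with a
constant depending only on `p` and `K` (`isMuckenhouptBasis_of_nested`); a union of `K₀` bases costs
a factor `K₀` (`IsMuckenhouptBasis.iUnion`).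

For a nested family, Doob's inequality bounds the maximal operator on `L^p(ν)` by `p'` for every
finite measure `ν`; no doubling is needed. With `q = p'`, `σ = w ^ (1 - q)`, `W = w μ` and `S = σ
μ`, the `A_p` condition gives pointwise `(M f) ^ (p - 1) ≤ K M_W (w⁻¹ (M_S (f σ⁻¹)) ^ (p - 1))`.
Doob's inequality for `M_W` on `L^q(W)` and for `M_S` on `L^p(S)` yields the constant `K ^ q p ^ q q
^ p`.

It remains to see that the tents are measurable, of positive volume and countably many.
Measurability and positivity come from a continuous substitute for the flow projection
(`exists_flowInverse`); countability comes from the disjointness of tents of the same generation. -/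

/-- A family of sets is nested if any two of its members that intersect are comparable. -/
def IsNested {ι α : Type*} (B : ι → Set α) : Prop :=
  ∀ i j, (B i ∩ B j).Nonempty → B i ⊆ B j ∨ B j ⊆ B i

/-- The maximal function of a family of sets with respect to a measure. -/
def nestedMax {ι α : Type*} [MeasurableSpace α] (μ : Measure α) (B : ι → Set α)
    (f : α → ℝ≥0∞) (x : α) : ℝ≥0∞ :=
  ⨆ i, (B i).indicator (fun _ => (μ (B i))⁻¹ * ∫⁻ y in B i, f y ∂μ) x

/-! ### Unweighted and weighted maximal inequalities for nested families. -/

section Nested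

variable {ι α : Type*} [MeasurableSpace α] {μ ν : Measure α} {B : ι → Set α}

/-- Split off a maximal member together with everything it contains: by nestedness the remaining
members are disjoint from it, so the inequalities add up. This replaces a covering lemma. -/
lemma IsNested.mul_measure_biUnion_le (hB : IsNested B) (hm : ∀ i, MeasurableSet (B i)) (c : ℝ≥0∞)
    (s : Finset ι) (h : ∀ i ∈ s, c * μ (B i) ≤ ν (B i)) :
    c * μ (⋃ i ∈ s, B i) ≤ ν (⋃ i ∈ s, B i) := by
  classical
  induction s using Finset.strongInduction with
  | H s ih =>
    rcases s.eq_empty_or_nonempty with rfl | hs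
    · simp
    obtain ⟨i, hi⟩ := s.exists_maximalFor B hs
    set t := s.filter (fun j => ¬ B j ⊆ B i) with ht
    have hts : t ⊂ s := by
      refine Finset.filter_ssubset.2 ⟨i, hi.1, by simp⟩
    have hU : (⋃ j ∈ s, B j) = B i ∪ ⋃ j ∈ t, B j := by
      ext x
      simp only [mem_iUnion, mem_union, ht, Finset.mem_filter, exists_prop]
      constructor
      · rintro ⟨j, hj, hx⟩
        by_cases hji : B j ⊆ B i
        · exact Or.inl (hji hx)
        · exact Or.inr ⟨j, ⟨hj, hji⟩, hx⟩
      · rintro (hx | ⟨j, hj, hx⟩)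
        · exact ⟨i, hi.1, hx⟩
        · exact ⟨j, hj.1, hx⟩
    have hd : Disjoint (B i) (⋃ j ∈ t, B j) := by
      simp only [disjoint_iUnion_right]
      intro j hj
      rw [ht, Finset.mem_filter] at hj
      rw [Set.disjoint_iff_inter_eq_empty, ← Set.not_nonempty_iff_eq_empty]
      intro hne
      rcases hB i j hne with h1 | h1
      · exact hj.2 (hi.2 hj.1 h1)
      · exact hj.2 h1
    have hmt : MeasurableSet (⋃ j ∈ t, B j) := t.measurableSet_biUnion fun j _ => hm j
    rw [hU, measure_union hd hmt, measure_union hd hmt, mul_add]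
    exact add_le_add (h i hi.1) (ih t hts fun j hj => h j (hts.1 hj))

lemma measurable_nestedMax [Countable ι] (hm : ∀ i, MeasurableSet (B i)) (f : α → ℝ≥0∞) :
    Measurable (nestedMax μ B f) :=
  Measurable.iSup fun i => measurable_const.indicator (hm i)

/-- The maximal inequality for a finite nested family. -/
lemma IsNested.mul_measure_lt_nestedMax_le [Finite ι] (hB : IsNested B)
    (hm : ∀ i, MeasurableSet (B i)) (f : α → ℝ≥0∞) (c : ℝ≥0∞) :
    c * μ {x | c < nestedMax μ B f x} ≤ μ.withDensity f {x | c < nestedMax μ B f x} := by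
  classical
  cases nonempty_fintype ι
  set s : Finset ι := Finset.univ.filter (fun i => c < (μ (B i))⁻¹ * ∫⁻ y in B i, f y ∂μ) with hs
  -- The superlevel set is exactly the union of the members whose average exceeds `c`.
  have hset : {x | c < nestedMax μ B f x} = ⋃ i ∈ s, B i := by
    ext x
    simp only [nestedMax, mem_ofPred_eq, lt_iSup_iff, mem_iUnion, hs, Finset.mem_filter,
      Finset.mem_univ, true_and, exists_prop]
    refine exists_congr fun i => ?_
    by_cases hx : x ∈ B i <;> simp [hx]
  rw [hset]
  refine hB.mul_measure_biUnion_le hm c s fun i hi => ?_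
  rw [withDensity_apply _ (hm i)]
  rw [hs, Finset.mem_filter] at hi
  calc c * μ (B i) ≤ ((μ (B i))⁻¹ * ∫⁻ y in B i, f y ∂μ) * μ (B i) := by gcongr; exact hi.2.le
    _ = (∫⁻ y in B i, f y ∂μ) * (μ (B i) * (μ (B i))⁻¹) := by ring
    _ ≤ (∫⁻ y in B i, f y ∂μ) * 1 := by gcongr; exact ENNReal.mul_inv_le_one _
    _ = _ := mul_one _

/-- Doob's `L^p` inequality, for a bounded function that satisfies the maximal inequality. -/
lemma lintegral_rpow_le_of_mul_measure_lt_le [IsFiniteMeasure μ] {f g : α → ℝ≥0∞}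
    (hf : Measurable f) (hg : Measurable g) {R : ℝ≥0} (hR : ∀ x, g x ≤ R)
    (hw : ∀ c : ℝ≥0∞, c * μ {x | c < g x} ≤ μ.withDensity f {x | c < g x})
    {p : ℝ} (hp : 1 < p) :
    ∫⁻ x, g x ^ p ∂μ ≤ ENNReal.ofReal p.conjExponent ^ p * ∫⁻ x, f x ^ p ∂μ := by
  have hp0 : 0 < p := by linarith
  have hpq : p.HolderConjugate p.conjExponent := Real.HolderConjugate.conjExponent hp
  have hgt : ∀ x, g x ≠ ⊤ := fun x => ne_top_of_le_ne_top ENNReal.coe_ne_top (hR x)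
  have hrep : ∀ q : ℝ, 0 ≤ q → ∀ x, g x ^ q = ENNReal.ofReal ((g x).toReal ^ q) := fun q hq x => by
    rw [← ENNReal.ofReal_rpow_of_nonneg ENNReal.toReal_nonneg hq, ENNReal.ofReal_toReal (hgt x)]
  have hset : ∀ t : ℝ, 0 < t → {x | t < (g x).toReal} = {x | ENNReal.ofReal t < g x} := by
    intro t ht
    ext x
    simp only [mem_ofPred_eq]
    rw [ENNReal.ofReal_lt_iff_lt_toReal ht.le (hgt x)]
  have hgm : ∀ κ : Measure α, AEMeasurable (fun x => (g x).toReal) κ :=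
    fun κ => hg.ennreal_toReal.aemeasurable
  have hnn : ∀ κ : Measure α, 0 ≤ᵐ[κ] fun x => (g x).toReal :=
    fun κ => Filter.Eventually.of_forall fun x => ENNReal.toReal_nonneg
  set I := ∫⁻ x, g x ^ p ∂μ with hI
  -- Layer-cake formula on both sides, with the weak-type bound inserted at each height `t`; `p' (p
  -- - 1) = p` matches the constants.
  have h1 : I ≤ ENNReal.ofReal p.conjExponent * ∫⁻ x, f x * g x ^ (p - 1) ∂μ := by
    have e1 : I = ENNReal.ofReal p * ∫⁻ t : ℝ in Ioi 0,
        μ {x | t < (g x).toReal} * ENNReal.ofReal (t ^ (p - 1)) := by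
      rw [← lintegral_rpow_eq_lintegral_meas_lt_mul μ (hnn μ) (hgm μ) hp0]
      exact lintegral_congr fun x => hrep p hp0.le x
    have e2 : ∫⁻ x, f x * g x ^ (p - 1) ∂μ = ENNReal.ofReal (p - 1) * ∫⁻ t : ℝ in Ioi 0,
        μ.withDensity f {x | t < (g x).toReal} * ENNReal.ofReal (t ^ (p - 1 - 1)) := by
      rw [← lintegral_rpow_eq_lintegral_meas_lt_mul (μ.withDensity f) (hnn _) (hgm _)
        (sub_pos.2 hp), lintegral_withDensity_eq_lintegral_mul _ hf (by fun_prop)]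
      exact lintegral_congr fun x => by
        rw [Pi.mul_apply, hrep (p - 1) (by linarith)]
    rw [e2, ← mul_assoc, ← ENNReal.ofReal_mul hpq.symm.nonneg, e1]
    have : p.conjExponent * (p - 1) = p := by
      rw [Real.conjExponent]; field_simp [(sub_pos.2 hp).ne']
    rw [this]
    gcongr 1
    refine setLIntegral_mono' measurableSet_Ioi fun t ht => ?_
    have ht : 0 < t := ht
    rw [hset t ht, show p - 1 = (p - 1 - 1) + 1 by ring, Real.rpow_add ht, Real.rpow_one,
      mul_comm (t ^ _), ENNReal.ofReal_mul ht.le, ← mul_assoc, mul_comm (μ _)]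
    rw [show p - 1 - 1 + 1 - 1 = p - 1 - 1 by ring]
    gcongr
    exact hw _
  have h2 : ∫⁻ x, f x * g x ^ (p - 1) ∂μ ≤
      (∫⁻ x, f x ^ p ∂μ) ^ (1 / p) * I ^ (1 / p.conjExponent) := by
    refine (ENNReal.lintegral_mul_le_Lp_mul_Lq μ hpq hf.aemeasurable
      (hg.pow_const (p - 1)).aemeasurable).trans_eq ?_
    congr 2
    refine lintegral_congr fun x => ?_
    rw [← ENNReal.rpow_mul, mul_comm, show p.conjExponent * (p - 1) = p by
      rw [Real.conjExponent]; field_simp [(sub_pos.2 hp).ne']]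
  -- Boundedness of `g` enters here: finiteness of `I` allows division by `I ^ (1 / p')` after
  -- Hölder.
  have hIt : I ≠ ⊤ := by
    refine ne_top_of_le_ne_top ?_ (lintegral_mono fun x =>
      ENNReal.rpow_le_rpow (hR x) hp0.le)
    rw [lintegral_const]
    exact ENNReal.mul_ne_top (ENNReal.rpow_ne_top_of_nonneg hp0.le ENNReal.coe_ne_top)
      (measure_ne_top _ _)
  rcases eq_or_ne I 0 with h0 | h0
  · rw [h0]; exact zero_le
  have h3 : I ^ (1 / p) ≤ ENNReal.ofReal p.conjExponent * (∫⁻ x, f x ^ p ∂μ) ^ (1 / p) := by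
    have hJ0 : I ^ (1 / p.conjExponent) ≠ 0 := by
      simp [ENNReal.rpow_eq_zero_iff, h0, hIt]
    have hJt : I ^ (1 / p.conjExponent) ≠ ⊤ :=
      ENNReal.rpow_ne_top_of_nonneg (one_div_nonneg.2 hpq.symm.nonneg) hIt
    refine (ENNReal.mul_le_mul_iff_left hJ0 hJt).1 ?_
    rw [← ENNReal.rpow_add _ _ h0 hIt]
    have : 1 / p + 1 / p.conjExponent = 1 := by simpa using hpq.inv_add_inv_eq_one
    rw [this, ENNReal.rpow_one, mul_assoc]
    exact h1.trans (by gcongr)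
  have h4 := ENNReal.rpow_le_rpow h3 hp0.le
  rwa [ENNReal.mul_rpow_of_nonneg _ _ hp0.le, ← ENNReal.rpow_mul, ← ENNReal.rpow_mul,
    one_div_mul_cancel hp0.ne', ENNReal.rpow_one, ENNReal.rpow_one] at h4

/-- Pointwise `f ≤ 1 + f ^ p`. This makes all averages finite, so that the maximal function of a
finite family is bounded. -/
lemma lintegral_ne_top_of_lintegral_rpow_ne_top [IsFiniteMeasure μ] {f : α → ℝ≥0∞} {p : ℝ}
    (hp : 1 < p) (hfin : ∫⁻ x, f x ^ p ∂μ ≠ ⊤) : ∫⁻ x, f x ∂μ ≠ ⊤ := by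
  refine ne_top_of_le_ne_top (b := ∫⁻ x, (1 + f x ^ p) ∂μ) ?_ (lintegral_mono fun x => ?_)
  · rw [lintegral_add_left measurable_const]
    simp [hfin]
  · rcases le_total (f x) 1 with h | h
    · exact h.trans le_self_add
    · exact (le_trans (by simpa using ENNReal.rpow_le_rpow_of_exponent_le h hp.le)
        le_add_self)

/-- The `L^p` inequality for the maximal function of a finite nested family. -/
lemma IsNested.lintegral_nestedMax_rpow_le_of_finite [Finite ι] [IsFiniteMeasure μ]
    (hB : IsNested B) (hm : ∀ i, MeasurableSet (B i)) {f : α → ℝ≥0∞} (hf : Measurable f) {p : ℝ}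
    (hp : 1 < p) :
    ∫⁻ x, nestedMax μ B f x ^ p ∂μ ≤
      ENNReal.ofReal p.conjExponent ^ p * ∫⁻ x, f x ^ p ∂μ := by
  cases nonempty_fintype ι
  have hp0 : 0 < p := by linarith
  rcases eq_or_ne (∫⁻ x, f x ^ p ∂μ) ⊤ with htop | hfin
  · rw [htop, ENNReal.mul_top]
    · exact le_top
    · have := (Real.HolderConjugate.conjExponent hp).symm.pos
      simp [ENNReal.rpow_eq_zero_iff, this, hp0]
  have hf1 := lintegral_ne_top_of_lintegral_rpow_ne_top hp hfin
  obtain ⟨a, ha⟩ : ∃ a : ι → ℝ≥0, ∀ i, (μ (B i))⁻¹ * ∫⁻ y in B i, f y ∂μ = a i := by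
    have havg : ∀ i, ∃ a : ℝ≥0, (μ (B i))⁻¹ * ∫⁻ y in B i, f y ∂μ = a := by
      intro i
      have : (μ (B i))⁻¹ * ∫⁻ y in B i, f y ∂μ ≠ ⊤ := by
        rcases eq_or_ne (μ (B i)) 0 with h0 | h0
        · rw [setLIntegral_measure_zero _ _ h0, mul_zero]
          exact ENNReal.zero_ne_top
        · exact ENNReal.mul_ne_top (ENNReal.inv_ne_top.2 h0)
            (ne_top_of_le_ne_top hf1 (setLIntegral_le_lintegral _ _))
      exact ⟨_, (ENNReal.coe_toNNReal this).symm⟩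
    exact ⟨fun i => (havg i).choose, fun i => (havg i).choose_spec⟩
  refine lintegral_rpow_le_of_mul_measure_lt_le (R := ∑ i, a i) hf (measurable_nestedMax hm f)
    (fun x => ?_) (fun c => hB.mul_measure_lt_nestedMax_le hm f c) hp
  refine iSup_le fun i => ?_
  rw [ha]
  refine (indicator_le_self' (fun _ _ => zero_le) x).trans ?_
  exact ENNReal.coe_le_coe.2
    (Finset.single_le_sum (f := a) (fun _ _ => zero_le) (Finset.mem_univ i))

lemma nestedMax_eq_iSup_fin (B : ℕ → Set α) (f : α → ℝ≥0∞) (x : α) :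
    nestedMax μ B f x = ⨆ N : ℕ, nestedMax μ (fun i : Fin N => B i) f x := by
  refine le_antisymm (iSup_le fun i => ?_) (iSup_le fun N => iSup_le fun i => ?_)
  · refine le_iSup_of_le (i + 1) ?_
    exact le_iSup_of_le (⟨i, Nat.lt_succ_self i⟩ : Fin (i + 1)) le_rfl
  · exact le_iSup_of_le (i : ℕ) le_rfl

/-- The `L^p` inequality for the maximal function of a sequence of nested sets. -/
lemma IsNested.lintegral_nestedMax_rpow_le [IsFiniteMeasure μ] {B : ℕ → Set α} (hB : IsNested B)
    (hm : ∀ i, MeasurableSet (B i)) {f : α → ℝ≥0∞} (hf : Measurable f) {p : ℝ} (hp : 1 < p) :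
    ∫⁻ x, nestedMax μ B f x ^ p ∂μ ≤
      ENNReal.ofReal p.conjExponent ^ p * ∫⁻ x, f x ^ p ∂μ := by
  have hp0 : 0 < p := by linarith
  have hsup : ∀ x, nestedMax μ B f x ^ p =
      ⨆ N : ℕ, nestedMax μ (fun i : Fin N => B i) f x ^ p := by
    intro x
    rw [nestedMax_eq_iSup_fin]
    exact (ENNReal.orderIsoRpow p hp0).map_iSup _
  simp_rw [hsup]
  rw [lintegral_iSup]
  · exact iSup_le fun N => IsNested.lintegral_nestedMax_rpow_le_of_finite
      (B := fun i : Fin N => B i) (fun i j => hB i j) (fun i => hm i) hf hp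
  · exact fun N => (measurable_nestedMax (B := fun i : Fin N => B i) (fun i => hm i) f).pow_const p
  · intro N M hNM x
    refine ENNReal.rpow_le_rpow (iSup_le fun i => ?_) hp0.le
    exact le_iSup_of_le (Fin.castLE hNM i) le_rfl

/-- The average of `f` over a set of an `A_p` family, in terms of averages for `w` and its dual
weight `σ`. -/
lemma rpow_average_le {a m S W J I : ℝ≥0∞} {K : ℝ≥0∞} {p : ℝ} (hp : 1 < p)
    (hm0 : m ≠ 0) (hmt : m ≠ ⊤) (hS0 : S ≠ 0) (hSt : S ≠ ⊤) (hW0 : W ≠ 0) (hWt : W ≠ ⊤)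
    (hK : (m⁻¹ * W) * (m⁻¹ * S) ^ (p - 1) ≤ K) (ha : a = S⁻¹ * J) (hI : m * a ^ (p - 1) ≤ I) :
    (m⁻¹ * J) ^ (p - 1) ≤ K * (W⁻¹ * I) := by
  have hJ : J = S * a := by
    rw [ha, ← mul_assoc, ENNReal.mul_inv_cancel hS0 hSt, one_mul]
  rw [hJ, ← mul_assoc, ENNReal.mul_rpow_of_nonneg _ _ (by linarith)]
  have h1 : (m⁻¹ * S) ^ (p - 1) ≤ K * (W⁻¹ * m) := by
    calc (m⁻¹ * S) ^ (p - 1)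
        = (m⁻¹ * W) * (m⁻¹ * S) ^ (p - 1) * (W⁻¹ * m) := by
          calc _ = (m⁻¹ * m) * (W * W⁻¹) * (m⁻¹ * S) ^ (p - 1) := by
                rw [ENNReal.inv_mul_cancel hm0 hmt, ENNReal.mul_inv_cancel hW0 hWt]; simp
            _ = _ := by ring
      _ ≤ _ := by gcongr
  calc (m⁻¹ * S) ^ (p - 1) * a ^ (p - 1) ≤ K * (W⁻¹ * m) * a ^ (p - 1) := by gcongr
    _ = K * (W⁻¹ * (m * a ^ (p - 1))) := by ring
    _ ≤ _ := by gcongr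

lemma conjExponent_conjExponent {p : ℝ} (hp : 1 < p) : p.conjExponent.conjExponent = p :=
  (Real.HolderConjugate.conjExponent hp).symm.conjExponent_eq

/-- The constant in the weighted inequality for the maximal function of a nested family. -/
def muckenhouptConst (p : ℝ) (K : ℝ≥0) : ℝ≥0 :=
  K ^ p.conjExponent * (p.toNNReal ^ p.conjExponent * p.conjExponent.toNNReal ^ p)

lemma coe_muckenhouptConst {p : ℝ} (hp : 1 < p) (K : ℝ≥0) :
    (muckenhouptConst p K : ℝ≥0∞) = (K : ℝ≥0∞) ^ p.conjExponent *
      (ENNReal.ofReal p.conjExponent.conjExponent ^ p.conjExponent *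
        ENNReal.ofReal p.conjExponent ^ p) := by
  have hq : 0 ≤ p.conjExponent := (Real.HolderConjugate.conjExponent hp).symm.nonneg
  rw [conjExponent_conjExponent hp, muckenhouptConst, ENNReal.coe_mul, ENNReal.coe_mul,
    ENNReal.coe_rpow_of_nonneg _ hq, ENNReal.coe_rpow_of_nonneg _ hq,
    ENNReal.coe_rpow_of_nonneg _ (by linarith : (0 : ℝ) ≤ p)]
  rfl

/-- The weighted inequality for a nested family, where the weight and its dual are integrable. -/
lemma IsNested.lintegral_nestedMax_rpow_mul_le_of_ne_top [IsFiniteMeasure μ] {B : ℕ → Set α}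
    (hB : IsNested B) (hm : ∀ i, MeasurableSet (B i)) (hpos : ∀ i, μ (B i) ≠ 0)
    {w : α → ℝ≥0} (hw : Measurable w) {p : ℝ} (hp : 1 < p) {K : ℝ≥0}
    (hA : ∀ i, ((μ (B i))⁻¹ * ∫⁻ x in B i, w x ∂μ) *
      ((μ (B i))⁻¹ * ∫⁻ x in B i, (w x : ℝ≥0∞) ^ (1 - p.conjExponent) ∂μ) ^ (p - 1) ≤ K)
    (hWt : ∫⁻ x, w x ∂μ ≠ ⊤) (hSt : ∫⁻ x, (w x : ℝ≥0∞) ^ (1 - p.conjExponent) ∂μ ≠ ⊤)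
    {f : α → ℝ≥0∞} (hf : Measurable f) :
    ∫⁻ x, nestedMax μ B f x ^ p * w x ∂μ ≤ muckenhouptConst p K * ∫⁻ x, f x ^ p * w x ∂μ := by
  have hp0 : 0 < p := by linarith
  have hpq : p.HolderConjugate p.conjExponent := Real.HolderConjugate.conjExponent hp
  set q := p.conjExponent with hq
  have hq1 : 1 < q := hpq.symm.lt
  set σ : α → ℝ≥0∞ := fun x => (w x : ℝ≥0∞) ^ (1 - q) with hσ
  have hwm : Measurable fun x => (w x : ℝ≥0∞) := hw.coe_nnreal_ennreal
  have hσm : Measurable σ := hwm.pow_const _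
  have hσt : ∀ᵐ x ∂μ, σ x < ⊤ := ae_lt_top hσm hSt
  have hw0 : ∀ᵐ x ∂μ, (w x : ℝ≥0∞) ≠ 0 := by
    filter_upwards [hσt] with x hx h0
    simp only [hσ] at hx
    rw [h0, ENNReal.zero_rpow_of_neg (by linarith)] at hx
    exact lt_irrefl _ hx
  have hσ0 : ∀ x, σ x ≠ 0 := fun x h => by
    rcases ENNReal.rpow_eq_zero_iff.1 h with h | h
    · linarith [h.2]
    · exact ENNReal.coe_ne_top h.1
  set W := μ.withDensity fun x => (w x : ℝ≥0∞) with hW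
  set S := μ.withDensity σ with hS
  have : IsFiniteMeasure W := isFiniteMeasure_withDensity hWt
  have : IsFiniteMeasure S := isFiniteMeasure_withDensity hSt
  have hWB : ∀ i, W (B i) = ∫⁻ x in B i, w x ∂μ := fun i => withDensity_apply _ (hm i)
  have hSB : ∀ i, S (B i) = ∫⁻ x in B i, σ x ∂μ := fun i => withDensity_apply _ (hm i)
  have hW0 : ∀ i, W (B i) ≠ 0 := fun i h => by
    rw [hWB, lintegral_eq_zero_iff hwm] at h
    refine hpos i ?_
    rw [← Measure.restrict_eq_zero, ← ae_eq_bot]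
    refine Filter.eventually_false_iff_eq_bot.1 ?_
    filter_upwards [h, ae_restrict_of_ae hw0] with x h1 h2 using h2 h1
  have hS0 : ∀ i, S (B i) ≠ 0 := fun i h => by
    rw [hSB, lintegral_eq_zero_iff hσm] at h
    refine hpos i ?_
    rw [← Measure.restrict_eq_zero, ← ae_eq_bot]
    refine Filter.eventually_false_iff_eq_bot.1 ?_
    filter_upwards [h] with x h1 using hσ0 x h1
  -- Dividing by the density turns integrals of `f` against `μ` into integrals of `φ` against `S`;
  -- `h` below plays the same role for `W`.
  set φ : α → ℝ≥0∞ := fun x => f x * (σ x)⁻¹ with hφ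
  have hφm : Measurable φ := hf.mul hσm.inv
  have hφB : ∀ i, ∫⁻ x in B i, φ x ∂S = ∫⁻ x in B i, f x ∂μ := fun i => by
    rw [hS, setLIntegral_withDensity_eq_setLIntegral_mul _ hσm hφm (hm i)]
    refine lintegral_congr_ae ?_
    filter_upwards [ae_restrict_of_ae hσt] with x hx
    simp only [Pi.mul_apply, hφ]
    rw [mul_comm, mul_assoc, ENNReal.inv_mul_cancel (hσ0 x) hx.ne, mul_one]
  set g := nestedMax S B φ with hg
  have hgm : Measurable g := measurable_nestedMax hm φ
  set h : α → ℝ≥0∞ := fun x => g x ^ (p - 1) * (w x : ℝ≥0∞)⁻¹ with hh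
  have hhm : Measurable h := (hgm.pow_const _).mul hwm.inv
  have hhB : ∀ i, ∫⁻ x in B i, h x ∂W = ∫⁻ x in B i, g x ^ (p - 1) ∂μ := fun i => by
    rw [hW, setLIntegral_withDensity_eq_setLIntegral_mul _ hwm hhm (hm i)]
    refine lintegral_congr_ae ?_
    filter_upwards [ae_restrict_of_ae hw0] with x hx
    simp only [Pi.mul_apply, hh]
    rw [mul_comm, mul_assoc, ENNReal.inv_mul_cancel hx ENNReal.coe_ne_top, mul_one]
  have hkey : ∀ i, ((μ (B i))⁻¹ * ∫⁻ x in B i, f x ∂μ) ^ (p - 1) ≤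
      K * ((W (B i))⁻¹ * ∫⁻ x in B i, h x ∂W) := fun i => by
    refine rpow_average_le (a := (S (B i))⁻¹ * ∫⁻ x in B i, φ x ∂S) hp (hpos i)
      (measure_ne_top _ _) (hS0 i) (measure_ne_top _ _) (hW0 i) (measure_ne_top _ _)
      (by rw [hWB, hSB]; exact hA i) (by rw [hφB]) ?_
    -- On `B i` the `S`-average of `φ` is at most `g`, so its power can be replaced by the
    -- `μ`-average of `g ^ (p - 1)`.
    rw [hhB, mul_comm, ← setLIntegral_const]
    refine setLIntegral_mono' (hm i) fun x hx => ENNReal.rpow_le_rpow ?_ (by linarith)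
    exact le_iSup_of_le (f := fun i => (B i).indicator
      (fun _ => (S (B i))⁻¹ * ∫⁻ y in B i, φ y ∂S) x) i (by rw [indicator_of_mem hx])
  have hpt : ∀ x, nestedMax μ B f x ^ p ≤ (K : ℝ≥0∞) ^ q * nestedMax W B h x ^ q := fun x => by
    have h1 : nestedMax μ B f x ≤ (K * nestedMax W B h x) ^ (p - 1)⁻¹ := by
      refine iSup_le fun i => ?_
      by_cases hx : x ∈ B i
      · rw [indicator_of_mem hx, ENNReal.le_rpow_inv_iff (by linarith)]
        refine (hkey i).trans ?_
        gcongr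
        exact le_iSup_of_le (f := fun i => (B i).indicator
          (fun _ => (W (B i))⁻¹ * ∫⁻ y in B i, h y ∂W) x) i (by rw [indicator_of_mem hx])
      · rw [indicator_of_notMem hx]; exact zero_le
    calc nestedMax μ B f x ^ p ≤ ((K * nestedMax W B h x) ^ (p - 1)⁻¹) ^ p :=
          ENNReal.rpow_le_rpow h1 hp0.le
      _ = (K * nestedMax W B h x) ^ q := by
          rw [← ENNReal.rpow_mul]; congr 1; rw [hq, Real.conjExponent]; ring
      _ = _ := ENNReal.mul_rpow_of_nonneg _ _ hpq.symm.nonneg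
  have hMm : Measurable (nestedMax W B h) := measurable_nestedMax hm h
  calc ∫⁻ x, nestedMax μ B f x ^ p * w x ∂μ
      ≤ ∫⁻ x, w x * ((K : ℝ≥0∞) ^ q * nestedMax W B h x ^ q) ∂μ :=
        lintegral_mono fun x => by rw [mul_comm]; gcongr; exact hpt x
    _ = ∫⁻ x, (K : ℝ≥0∞) ^ q * nestedMax W B h x ^ q ∂W := by
        rw [hW, lintegral_withDensity_eq_lintegral_mul _ hwm ((hMm.pow_const q).const_mul _)]
        rfl
    _ = (K : ℝ≥0∞) ^ q * ∫⁻ x, nestedMax W B h x ^ q ∂W :=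
        lintegral_const_mul _ (hMm.pow_const q)
    _ ≤ (K : ℝ≥0∞) ^ q * (ENNReal.ofReal q.conjExponent ^ q * ∫⁻ x, h x ^ q ∂W) := by
        gcongr; exact hB.lintegral_nestedMax_rpow_le hm hhm hq1
    _ = (K : ℝ≥0∞) ^ q * (ENNReal.ofReal q.conjExponent ^ q * ∫⁻ x, g x ^ p ∂S) := by
        -- Here `h ^ q w = g ^ p w ^ (1 - q) = g ^ p σ`, as `(p - 1) q = p`.
        congr 2
        rw [hW, hS, lintegral_withDensity_eq_lintegral_mul _ hwm (hhm.pow_const q),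
          lintegral_withDensity_eq_lintegral_mul _ hσm (hgm.pow_const p)]
        refine lintegral_congr_ae ?_
        filter_upwards [hw0] with x hx
        simp only [Pi.mul_apply, hh, hσ]
        rw [ENNReal.mul_rpow_of_nonneg _ _ hpq.symm.nonneg, ← ENNReal.rpow_mul,
          ENNReal.inv_rpow, ← ENNReal.rpow_neg, sub_eq_add_neg 1 q,
          ENNReal.rpow_add _ _ hx ENNReal.coe_ne_top, ENNReal.rpow_one]
        rw [show (p - 1) * q = p by
          rw [hq, Real.conjExponent]; field_simp [(sub_pos.2 hp).ne']]
        ring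
    _ ≤ (K : ℝ≥0∞) ^ q * (ENNReal.ofReal q.conjExponent ^ q *
          (ENNReal.ofReal q ^ p * ∫⁻ x, φ x ^ p ∂S)) := by
        gcongr; exact hB.lintegral_nestedMax_rpow_le hm hφm hp
    _ = muckenhouptConst p K * ∫⁻ x, φ x ^ p ∂S := by
        rw [coe_muckenhouptConst hp, ← hq]; ring
    _ = _ := by
        -- Here `φ ^ p σ = f ^ p σ ^ (1 - p) = f ^ p w`, as `(1 - q) (1 - p) = 1`.
        congr 1
        rw [hS, lintegral_withDensity_eq_lintegral_mul _ hσm (hφm.pow_const p)]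
        refine lintegral_congr_ae ?_
        filter_upwards [hw0] with x hx
        simp only [Pi.mul_apply, hφ, hσ]
        rw [ENNReal.mul_rpow_of_nonneg _ _ hp0.le, ← ENNReal.rpow_neg, ← ENNReal.rpow_mul,
          mul_comm, mul_assoc, ← ENNReal.rpow_add _ _ hx ENNReal.coe_ne_top]
        rw [show -(1 - q) * p + (1 - q) = 1 by
          rw [hq, Real.conjExponent]; field_simp [(sub_pos.2 hp).ne']; ring, ENNReal.rpow_one]

/-- The weighted inequality for a nested family that contains the whole space. -/
lemma IsNested.lintegral_nestedMax_rpow_mul_le [IsFiniteMeasure μ] {B : ℕ → Set α}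
    (hB : IsNested B) (hm : ∀ i, MeasurableSet (B i)) (hpos : ∀ i, μ (B i) ≠ 0)
    {i₀ : ℕ} (hi₀ : ∀ᵐ x ∂μ, x ∈ B i₀)
    {w : α → ℝ≥0} (hw : Measurable w) {p : ℝ} (hp : 1 < p) {K : ℝ≥0}
    (hA : ∀ i, ((μ (B i))⁻¹ * ∫⁻ x in B i, w x ∂μ) *
      ((μ (B i))⁻¹ * ∫⁻ x in B i, (w x : ℝ≥0∞) ^ (1 - p.conjExponent) ∂μ) ^ (p - 1) ≤ K)
    {f : α → ℝ≥0∞} (hf : Measurable f) :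
    ∫⁻ x, nestedMax μ B f x ^ p * w x ∂μ ≤ muckenhouptConst p K * ∫⁻ x, f x ^ p * w x ∂μ := by
  have hpq : p.HolderConjugate p.conjExponent := Real.HolderConjugate.conjExponent hp
  have hwm : Measurable fun x => (w x : ℝ≥0∞) := hw.coe_nnreal_ennreal
  have hres : μ.restrict (B i₀) = μ := Measure.restrict_eq_self_of_ae_mem hi₀
  have hinv : (μ (B i₀))⁻¹ ≠ 0 := ENNReal.inv_ne_zero.2 (measure_ne_top _ _)
  have h := hA i₀
  rw [hres] at h
  -- With `0 * ∞ = 0`, a weight vanishing a.e. satisfies the `A_p` bound while its dual is not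
  -- integrable, hence the separate case. Otherwise the bound on the full set `B i₀` forces both
  -- integrals to be finite.
  rcases eq_or_ne (∫⁻ x, w x ∂μ) 0 with h0 | h0
  · rw [lintegral_eq_zero_iff hwm] at h0
    refine le_of_eq_of_le ?_ zero_le
    rw [← lintegral_zero (μ := μ)]
    refine lintegral_congr_ae ?_
    filter_upwards [h0] with x hx
    rw [hx]; simp
  have hSt : ∫⁻ x, (w x : ℝ≥0∞) ^ (1 - p.conjExponent) ∂μ ≠ ⊤ := by
    intro ht
    rw [ht, ENNReal.mul_top hinv, ENNReal.top_rpow_of_pos (by linarith),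
      ENNReal.mul_top (mul_ne_zero hinv h0)] at h
    exact ENNReal.coe_ne_top (top_le_iff.1 h)
  have hWt : ∫⁻ x, w x ∂μ ≠ ⊤ := by
    intro ht
    have hS0 : ∫⁻ x, (w x : ℝ≥0∞) ^ (1 - p.conjExponent) ∂μ = 0 := by
      by_contra hS0
      have hne : ((μ (B i₀))⁻¹ * ∫⁻ x, (w x : ℝ≥0∞) ^ (1 - p.conjExponent) ∂μ) ^ (p - 1) ≠ 0 := by
        have hp1 : 0 < p - 1 := by linarith
        rw [Ne, ENNReal.rpow_eq_zero_iff_of_pos hp1]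
        exact mul_ne_zero hinv hS0
      rw [ht, ENNReal.mul_top hinv, ENNReal.top_mul hne] at h
      exact ENNReal.coe_ne_top (top_le_iff.1 h)
    rw [lintegral_eq_zero_iff (hwm.pow_const _)] at hS0
    refine hpos i₀ (measure_mono_null (subset_univ _) ?_)
    rw [Measure.measure_univ_eq_zero, ← ae_eq_bot]
    refine Filter.eventually_false_iff_eq_bot.1 ?_
    filter_upwards [hS0] with x hx
    rcases ENNReal.rpow_eq_zero_iff.1 hx with h | h
    · linarith [h.2, hpq.symm.lt]
    · exact ENNReal.coe_ne_top h.1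
  exact hB.lintegral_nestedMax_rpow_mul_le_of_ne_top hm hpos hw hp hA hWt hSt hf

end Nested

/-! ### The gradient flow and a continuous extension of the projection. -/

section Flow

variable {r : Cn n → ℝ}

lemma contDiff_gradient (h : ContDiff ℝ ∞ r) : ContDiff ℝ ∞ (gradient r) :=
  (InnerProductSpace.toDual ℝ (Cn n)).symm.contDiff.comp (h.fderiv_right (by simp))

/-- The inversion `g ↦ -g / |g|²`, smoothly cut off near the origin. -/
def cutInversion (g : Cn n) : Cn n :=
  -((Real.smoothTransition (9 * ‖g‖ ^ 2 - 1) * (‖g‖ ^ 2)⁻¹) • g)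

lemma cutInversion_of_le {g : Cn n} (h : 2 / 3 ≤ ‖g‖) :
    cutInversion g = -((‖g‖ ^ 2)⁻¹ • g) := by
  -- The cutoff is 0 for `‖g‖ ≤ 1/3` and 1 as soon as `9 ‖g‖ ^ 2 ≥ 2`, which `‖g‖ ≥ 2/3` ensures.
  rw [cutInversion, Real.smoothTransition.one_of_one_le (by nlinarith), one_mul]

lemma contDiff_cutInversion : ContDiff ℝ ∞ (cutInversion (n := n)) := by
  rw [contDiff_iff_contDiffAt]
  intro g
  have hsq : ContDiff ℝ ∞ fun g : Cn n => ‖g‖ ^ 2 := contDiff_norm_sq ℝ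
  rcases eq_or_ne g 0 with rfl | hg
  · refine (contDiffAt_const (c := (0 : Cn n))).congr_of_eventuallyEq ?_
    filter_upwards [Metric.ball_mem_nhds (0 : Cn n) (by norm_num : (0 : ℝ) < 1 / 3)] with x hx
    rw [mem_ball_zero_iff] at hx
    rw [cutInversion, Real.smoothTransition.zero_of_nonpos (by nlinarith [norm_nonneg x])]
    simp
  · have h1 : ContDiffAt ℝ ∞ (fun g : Cn n => (‖g‖ ^ 2)⁻¹) g :=
      hsq.contDiffAt.inv (by simpa using hg)
    have h2 : ContDiffAt ℝ ∞ (fun g : Cn n => Real.smoothTransition (9 * ‖g‖ ^ 2 - 1)) g :=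
      (Real.smoothTransition.contDiff.comp
        ((contDiff_const.mul hsq).sub contDiff_const)).contDiffAt
    exact ((h2.mul h1).smul contDiffAt_id).neg

/-- The normal field agrees, on bounded sets where the gradient is not small, with a bounded and
Lipschitz field. -/
lemma exists_lipschitz_field (h : ContDiff ℝ ∞ r) (R : ℝ) :
    ∃ (Y : Cn n → Cn n) (K L : ℝ≥0), LipschitzWith K Y ∧ (∀ z, ‖Y z‖ ≤ L) ∧
      ∀ z, ‖z‖ ≤ R → 2 / 3 ≤ ‖gradient r z‖ → Y z = normalField r z := by
  let b : ContDiffBump (0 : Cn n) := ⟨|R| + 1, |R| + 2, by positivity, by linarith⟩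
  set Y : Cn n → Cn n := fun z => b z • cutInversion (gradient r z) with hY
  have hYs : ContDiff ℝ ∞ Y := b.contDiff.smul (contDiff_cutInversion.comp (contDiff_gradient h))
  have hYc : HasCompactSupport Y := b.hasCompactSupport.smul_right
  obtain ⟨K, hK⟩ := ContDiff.lipschitzWith_of_hasCompactSupport hYc hYs (by simp)
  obtain ⟨L, hL⟩ := hYs.continuous.bounded_above_of_compact_support hYc
  refine ⟨Y, K, L.toNNReal, hK, fun z => (hL z).trans (Real.le_coe_toNNReal L), ?_⟩
  intro z hz hg
  have hb : b z = 1 := b.one_of_mem_closedBall (by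
    rw [mem_closedBall_zero_iff]
    exact hz.trans ((le_abs_self R).trans (by change |R| ≤ |R| + 1; linarith)))
  simp only [hY]
  rw [hb, one_smul, cutInversion_of_le hg, normalField]

/-- At speed at most `L`, a solution from the ball of radius `R` stays in the ball of radius `R + L
T` up to time `T`; this is the room that Picard–Lindelöf requires. -/
lemma exists_flow {E : Type*} [NormedAddCommGroup E] [NormedSpace ℝ E] [CompleteSpace E]
    {Y : E → E} {K L : ℝ≥0} (hK : LipschitzWith K Y) (hL : ∀ z, ‖Y z‖ ≤ L) (R T : ℝ≥0) :
    ∃ φ : E × ℝ → E, (∀ x ∈ Metric.closedBall (0 : E) R, φ (x, 0) = x ∧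
      ∀ t ∈ Icc (-T : ℝ) T, HasDerivWithinAt (fun t => φ (x, t)) (Y (φ (x, t))) (Icc (-T : ℝ) T) t) ∧
      ContinuousOn φ (Metric.closedBall (0 : E) R ×ˢ Icc (-T : ℝ) T) := by
  have : IsPicardLindelof (fun _ => Y) (⟨0, by simp⟩ : Icc (-T : ℝ) T) 0 (R + L * T) R L K :=
    .of_time_independent (fun x _ => hL x) hK.lipschitzOnWith (by simp)
  exact this.exists_forall_mem_closedBall_eq_hasDerivWithinAt_continuousOn

/-- The function decreases with unit speed along the flow lines of its normal field. -/
lemma apply_eq_sub_of_hasDerivWithinAt (h : ContDiff ℝ ∞ r) {γ : ℝ → Cn n} {b : ℝ}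
    (hγ : ∀ t ∈ Icc 0 b, HasDerivWithinAt γ (normalField r (γ t)) (Icc 0 b) t)
    (h0 : ∀ t ∈ Icc 0 b, gradient r (γ t) ≠ 0) :
    ∀ t ∈ Icc 0 b, r (γ t) = r (γ 0) - t := by
  have hd : ∀ t ∈ Icc 0 b, HasDerivWithinAt (fun t => r (γ t) + t) 0 (Icc 0 b) t := by
    intro t ht
    have h1 := ((h.differentiable (by simp)) (γ t)).hasGradientAt.hasFDerivAt.comp_hasDerivWithinAt
      t (hγ t ht)
    have h2 := h1.add (hasDerivWithinAt_id t (Icc 0 b))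
    refine h2.congr_deriv ?_
    have hn : ‖gradient r (γ t)‖ ≠ 0 := norm_ne_zero_iff.2 (h0 t ht)
    rw [InnerProductSpace.toDual_apply_apply, normalField, inner_neg_right, inner_smul_right,
      real_inner_self_eq_norm_sq, inv_mul_cancel₀ (pow_ne_zero 2 hn)]
    norm_num
  intro t ht
  have := constant_of_has_deriv_right_zero (fun t ht => (hd t ht).continuousWithinAt)
    (fun t ht => (hd t (Ico_subset_Icc_self ht)).mono_of_mem_nhdsWithin
      (Icc_mem_nhdsGE_of_mem ht)) t ht
  simp only [add_zero] at this
  linarith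

/-- Uniqueness from the left end identifies the flow line issuing from a boundary point; uniqueness
from the right end shows that only one boundary point can flow into a given `z`. -/
lemma eqOn_Icc_of_lipschitz {E : Type*} [NormedAddCommGroup E] [NormedSpace ℝ E]
    {Y : E → E} {K : ℝ≥0} (hK : LipschitzWith K Y) {b : ℝ} {γ β : ℝ → E}
    (hγ : ∀ t ∈ Icc 0 b, HasDerivWithinAt γ (Y (γ t)) (Icc 0 b) t)
    (hβ : ∀ t ∈ Icc 0 b, HasDerivWithinAt β (Y (β t)) (Icc 0 b) t)
    (h : γ 0 = β 0 ∨ γ b = β b) : EqOn γ β (Icc 0 b) := by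
  rcases h with h | h
  · exact ODE_solution_unique (v := fun _ => Y) (fun _ => hK)
      (fun t ht => (hγ t ht).continuousWithinAt)
      (fun t ht => (hγ t (Ico_subset_Icc_self ht)).mono_of_mem_nhdsWithin
        (Icc_mem_nhdsGE_of_mem ht))
      (fun t ht => (hβ t ht).continuousWithinAt)
      (fun t ht => (hβ t (Ico_subset_Icc_self ht)).mono_of_mem_nhdsWithin
        (Icc_mem_nhdsGE_of_mem ht)) h
  · exact ODE_solution_unique_of_mem_Icc_left (v := fun _ => Y) (s := fun _ => univ)
      (fun _ _ => hK.lipschitzOnWith)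
      (fun t ht => (hγ t ht).continuousWithinAt)
      (fun t ht => (hγ t (Ioc_subset_Icc_self ht)).mono_of_mem_nhdsWithin
        (Icc_mem_nhdsLE_of_mem ht)) (fun _ _ => mem_univ _)
      (fun t ht => (hβ t ht).continuousWithinAt)
      (fun t ht => (hβ t (Ioc_subset_Icc_self ht)).mono_of_mem_nhdsWithin
        (Icc_mem_nhdsLE_of_mem ht)) (fun _ _ => mem_univ _) h

variable {M : ℕ} {U V : Set (Cn n)} {t₀ : ℝ}

lemma isOpen_domain (h : Continuous r) : IsOpen (domain r) := isOpen_lt h continuous_const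

lemma apply_eq_zero_of_mem_bdry (h : Continuous r) {z : Cn n} (hz : z ∈ bdry r) : r z = 0 :=
  frontier_lt_subset_eq h continuous_const hz

lemma mem_bdry_iff (h : Continuous r) {z : Cn n} :
    z ∈ bdry r ↔ z ∈ closure (domain r) ∧ r z = 0 := by
  refine ⟨fun hz => ⟨frontier_subset_closure hz, apply_eq_zero_of_mem_bdry h hz⟩, fun hz => ?_⟩
  rw [bdry, (isOpen_domain h).frontier_eq]
  exact ⟨hz.1, by simp [domain, hz.2]⟩

lemma IsFlowLine.apply_eq (h : ContDiff ℝ ∞ r) (hU : IsFlowNeighborhood r U V t₀) {x : Cn n}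
    {b : ℝ} {γ : ℝ → Cn n} (hx : x ∈ bdry r) (hγ : IsFlowLine r U (Icc 0 b) x γ) :
    ∀ t ∈ Icc 0 b, r (γ t) = -t := by
  intro t ht
  rw [apply_eq_sub_of_hasDerivWithinAt h (fun t ht => (hγ.2 t ht).2) (fun t ht h0 => ?_) t ht,
    hγ.1, apply_eq_zero_of_mem_bdry h.continuous hx, zero_sub]
  have := (hU.gradient_bounds _ (hγ.2 t ht).1).1
  rw [h0, norm_zero] at this
  linarith

/-- This confines flow lines to a bounded set, where the normal field agrees with its globally
Lipschitz replacement. -/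
lemma IsFlowLine.mem_closure_domain (h : ContDiff ℝ ∞ r) (hU : IsFlowNeighborhood r U V t₀)
    {x : Cn n} {b : ℝ} {γ : ℝ → Cn n} (hx : x ∈ bdry r) (hγ : IsFlowLine r U (Icc 0 b) x γ) :
    ∀ t ∈ Icc 0 b, γ t ∈ closure (domain r) := by
  intro t ht
  rcases eq_or_lt_of_le ht.1 with h0 | h0
  · rw [← h0, hγ.1]
    exact frontier_subset_closure hx
  · refine subset_closure ?_
    change r (γ t) < 0
    rw [hγ.apply_eq h hU hx t ht]
    linarith

/-- Turns the backward trajectory of a point into a forward one that reaches it at time `b`. -/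
lemma hasDerivWithinAt_shift {E : Type*} [NormedAddCommGroup E] [NormedSpace ℝ E]
    {α : ℝ → E} {Y : E → E} {T b : ℝ}
    (hα : ∀ t ∈ Icc (-T) T, HasDerivWithinAt α (Y (α t)) (Icc (-T) T) t) (hb : b ≤ T) (hT : 0 ≤ T) :
    ∀ t ∈ Icc 0 b, HasDerivWithinAt (fun t => α (t - b)) (Y (α (t - b))) (Icc 0 b) t := by
  intro t ht
  have hmaps : MapsTo (fun t => t - b) (Icc 0 b) (Icc (-T) T) := fun s hs =>
    ⟨by linarith [hs.1], by linarith [hs.2]⟩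
  have := (hα (t - b) (hmaps ht)).scomp t
    ((hasDerivWithinAt_id t (Icc 0 b)).sub_const b) hmaps
  simpa [Function.comp_def] using this

/-- The projection along the flow lines extends to a continuous map. -/
lemma exists_flowInverse (h : ContDiff ℝ ∞ r) (hbd : Bornology.IsBounded (domain r))
    (hU : IsFlowNeighborhood r U V t₀) :
    ∃ Ψ : Cn n → Cn n, ContinuousOn Ψ {z | r z ∈ Ioo (-t₀) 0} ∧
      (∀ z, r z ∈ Ioo (-t₀) 0 → ∀ x, FlowsTo r U x z → x = Ψ z) ∧
      (∀ z, r z ∈ Ioo (-t₀) 0 → Ψ z ∈ bdry r → FlowsTo r U (Ψ z) z) ∧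
      (∀ c ∈ bdry r, ∀ s > 0, ∃ η > 0, ∀ z ∈ Metric.ball c η, r z ∈ Ioo (-t₀) 0 →
        Ψ z ∈ bdry r ∧ Ψ z ∈ Metric.ball c s) := by
  obtain ⟨R, hR⟩ := hbd.closure.subset_closedBall (0 : Cn n)
  have hR' : ∀ z ∈ closure (domain r), ‖z‖ ≤ R := fun z hz => mem_closedBall_zero_iff.1 (hR hz)
  -- Radius `R + 1` because backward trajectories near the boundary may leave the closed domain
  -- before this is excluded; they stay within distance 1 of a boundary point.
  obtain ⟨Y, K, L, hK, hL, hY⟩ := exists_lipschitz_field h (R + 1)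
  set T : ℝ≥0 := t₀.toNNReal with hT
  have hTt : (T : ℝ) = t₀ := Real.coe_toNNReal _ hU.t₀_pos.le
  obtain ⟨φ, hφ, hφc⟩ := exists_flow hK hL R.toNNReal T
  rw [hTt] at hφ hφc
  have hdom : ∀ z, r z ∈ Ioo (-t₀) 0 → z ∈ Metric.closedBall (0 : Cn n) R.toNNReal := by
    intro z hz
    rw [mem_closedBall_zero_iff]
    exact (hR' z (subset_closure hz.2)).trans (Real.le_coe_toNNReal R)
  -- the flow line of the extended field that ends in `z`
  have hline : ∀ z, r z ∈ Ioo (-t₀) 0 → ∀ t ∈ Icc 0 (-r z),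
      HasDerivWithinAt (fun t => φ (z, t - -r z)) (Y (φ (z, t - -r z))) (Icc 0 (-r z)) t := by
    intro z hz
    exact hasDerivWithinAt_shift (α := fun t => φ (z, t)) (hφ z (hdom z hz)).2
      (by linarith [hz.1]) hU.t₀_pos.le
  have hend : ∀ z, r z ∈ Ioo (-t₀) 0 → φ (z, -r z - -r z) = z := by
    intro z hz
    rw [sub_self]; exact (hφ z (hdom z hz)).1
  have hstart : ∀ z, φ (z, 0 - -r z) = φ (z, r z) := fun z => by rw [zero_sub, neg_neg]
  -- flow lines are flow lines of the extended field
  have hflowY : ∀ x ∈ bdry r, ∀ b : ℝ, ∀ γ, IsFlowLine r U (Icc 0 b) x γ →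
      ∀ t ∈ Icc 0 b, HasDerivWithinAt γ (Y (γ t)) (Icc 0 b) t := by
    intro x hx b γ hγ t ht
    rw [hY]
    · exact (hγ.2 t ht).2
    · exact (hR' _ (hγ.mem_closure_domain h hU hx t ht)).trans (by linarith)
    · exact (hU.gradient_bounds _ (hγ.2 t ht).1).1
  -- Since `r z < 0`, this follows the extended field backwards for time `-r z`.
  refine ⟨fun z => φ (z, r z), ?_, ?_, ?_, ?_⟩
  · refine hφc.comp (continuous_id.prodMk h.continuous).continuousOn fun z hz => ?_
    exact ⟨hdom z hz, hz.1.le, hz.2.le.trans hU.t₀_pos.le⟩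
  · rintro z hz x ⟨hx, γ, hγ, hγz⟩
    have := eqOn_Icc_of_lipschitz hK (hflowY x hx _ γ hγ) (hline z hz)
      (Or.inr (by rw [hγz, hend z hz])) (left_mem_Icc.2 (by linarith [hz.2]))
    simp only [hstart] at this
    exact hγ.1.symm.trans this
  · intro z hz hx
    refine ⟨hx, ?_⟩
    obtain ⟨γ, hγ⟩ := hU.flow _ (hU.bdry_subset hx)
    have hsub : Icc 0 (-r z) ⊆ Ico 0 t₀ := fun t ht => ⟨ht.1, by linarith [ht.2, hz.1]⟩
    have hγ' : IsFlowLine r U (Icc 0 (-r z)) (φ (z, r z)) γ :=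
      ⟨hγ.1, fun t ht => ⟨(hγ.2 t (hsub ht)).1, (hγ.2 t (hsub ht)).2.mono hsub⟩⟩
    refine ⟨γ, hγ', ?_⟩
    have := eqOn_Icc_of_lipschitz hK (hflowY _ hx _ γ hγ') (hline z hz)
      (Or.inl (by rw [hγ.1, hstart])) (right_mem_Icc.2 (by linarith [hz.2]))
    simp only [hend z hz] at this
    exact this
  · intro c hc s hs
    have hcR : ‖c‖ ≤ R := hR' c (frontier_subset_closure hc)
    obtain ⟨ρ, hρ, hρU⟩ := Metric.isOpen_iff.1 hU.isOpen_U c (hU.subset (hU.bdry_subset hc))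
    set m := min (min ρ s) 1 with hm
    have hm0 : 0 < m := by positivity
    have hcont := h.continuous.tendsto c
    rw [apply_eq_zero_of_mem_bdry h.continuous hc, Metric.tendsto_nhds] at hcont
    -- This bound on `|r z|` keeps the path from `z`, of length at most `L |r z|`, shorter than `m /
    -- 2`. The whole backward trajectory then stays within `m` of `c`, hence in `U`, where `r`
    -- changes at unit speed and reaches 0.
    obtain ⟨η', hη', hball⟩ := Metric.eventually_nhds_iff_ball.1
      (hcont (m / (2 * (L + 1))) (by positivity))
    refine ⟨min η' (m / 2), by positivity, fun z hz hrz => ?_⟩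
    have hzc : dist z c < m / 2 := (Metric.mem_ball.1 hz).trans_le (min_le_right _ _)
    have hrsmall : L * -r z < m / 2 := by
      have h1 := hball z (Metric.ball_subset_ball (min_le_left _ _) hz)
      rw [Real.dist_eq, sub_zero, abs_of_neg hrz.2, lt_div_iff₀ (by positivity)] at h1
      nlinarith [hrz.2]
    have hclose : ∀ t ∈ Icc 0 (-r z), dist (φ (z, t - -r z)) c < m := by
      intro t ht
      have hr : -r z ∈ Icc 0 (-r z) := right_mem_Icc.2 (by linarith [hrz.2])
      have h1 := Convex.norm_image_sub_le_of_norm_hasDerivWithin_le (hline z hrz)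
        (fun t _ => hL _) (convex_Icc _ _) hr ht
      rw [hend z hrz, ← dist_eq_norm] at h1
      have h2 : ‖t - -r z‖ ≤ -r z := by
        rw [Real.norm_eq_abs, abs_le]; constructor <;> linarith [ht.1, ht.2]
      have h3 : (L : ℝ) * ‖t - -r z‖ ≤ L * -r z := by gcongr
      linarith [dist_triangle (φ (z, t - -r z)) z c]
    have hgrad : ∀ t ∈ Icc 0 (-r z), 2 / 3 ≤ ‖gradient r (φ (z, t - -r z))‖ := fun t ht =>
      (hU.gradient_bounds _ (hρU ((hclose t ht).trans_le
        ((min_le_left _ _).trans (min_le_left _ _))))).1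
    have hr : ∀ t ∈ Icc 0 (-r z), r (φ (z, t - -r z)) = r (φ (z, 0 - -r z)) - t := by
      refine apply_eq_sub_of_hasDerivWithinAt h (fun t ht => ?_) (fun t ht h0 => ?_)
      · rw [← hY]
        · exact hline z hrz t ht
        · have h1 := norm_le_norm_add_norm_sub' (φ (z, t - -r z)) c
          rw [← dist_eq_norm] at h1
          have h2 : m ≤ 1 := min_le_right _ _
          linarith [hclose t ht]
        · exact hgrad t ht
      · have := hgrad t ht
        rw [h0, norm_zero] at this
        linarith
    have h0 : r (φ (z, r z)) = 0 := by
      have := hr (-r z) (right_mem_Icc.2 (by linarith [hrz.2]))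
      rw [hend z hrz, hstart] at this
      linarith
    have hc0 := hclose 0 (left_mem_Icc.2 (by linarith [hrz.2]))
    rw [hstart] at hc0
    refine ⟨(mem_bdry_iff h.continuous).2 ⟨?_, h0⟩,
      hc0.trans_le ((min_le_left _ _).trans (min_le_right _ _))⟩
    -- `r = 0` alone is not enough for a boundary point: the start is also the limit, as `t`
    -- decreases to 0, of points with `r = -t < 0`.
    have hcw : ContinuousWithinAt (fun t => φ (z, t - -r z)) (Icc 0 (-r z)) 0 :=
      (hline z hrz 0 (left_mem_Icc.2 (by linarith [hrz.2]))).continuousWithinAt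
    have hmem : (0 : ℝ) ∈ closure (Ioc 0 (-r z)) := by
      rw [closure_Ioc (by linarith [hrz.2] : (0 : ℝ) ≠ -r z)]
      exact left_mem_Icc.2 (by linarith [hrz.2])
    have := (hcw.mono Ioc_subset_Icc_self).mem_closure hmem (t := domain r) fun t ht => by
      change r (φ (z, t - -r z)) < 0
      rw [hr t (Ioc_subset_Icc_self ht), hstart, h0]
      linarith [ht.1]
    rwa [hstart] at this

end Flow

/-! ### From nested families to Muckenhoupt bases. -/

section Muckenhoupt

lemma maximalOp_range (B : ℕ → Set (Cn n)) (f : Cn n → ℂ) (z : Cn n) :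
    maximalOp (range B) f z =
      ⨆ i, (B i).indicator (fun _ => avg (B i) fun y => ‖f y‖ₑ) z := by
  refine le_antisymm (iSup₂_le ?_) (iSup_le fun i => ?_)
  · rintro _ ⟨⟨i, rfl⟩, hz⟩
    exact le_iSup_of_le i (by rw [indicator_of_mem hz])
  · by_cases hz : z ∈ B i
    · rw [indicator_of_mem hz]
      exact le_iSup₂_of_le (B i) ⟨⟨i, rfl⟩, hz⟩ le_rfl
    · rw [indicator_of_notMem hz]
      exact zero_le

lemma avg_congr {Ω B : Set (Cn n)} (hB : B ⊆ Ω) {g h : Cn n → ℝ≥0∞}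
    (hgh : g =ᵐ[volume.restrict Ω] h) : avg B g = avg B h := by
  rw [avg, avg, lintegral_congr_ae (ae_restrict_of_ae_restrict_of_subset hB hgh)]

lemma avg_eq_restrict {Ω B : Set (Cn n)} (hB : B ⊆ Ω) (hm : MeasurableSet B) (g : Cn n → ℝ≥0∞) :
    avg B g = (volume.restrict Ω B)⁻¹ * ∫⁻ z in B, g z ∂volume.restrict Ω := by
  rw [Measure.restrict_restrict hm, inter_eq_self_of_subset_left hB, Measure.restrict_apply hm,
    inter_eq_self_of_subset_left hB, avg]

/-- A countable nested basis that contains the whole domain is a Muckenhoupt basis. -/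
theorem isMuckenhouptBasis_of_nested {Ω : Set (Cn n)} (hΩ : volume Ω ≠ ⊤)
    {𝓑 : Set (Set (Cn n))} (hb : IsBasis Ω 𝓑) (hc : 𝓑.Countable) (hmem : Ω ∈ 𝓑)
    (hn : ∀ A ∈ 𝓑, ∀ B ∈ 𝓑, (A ∩ B).Nonempty → A ⊆ B ∨ B ⊆ A) :
    IsMuckenhouptBasis Ω 𝓑 muckenhouptConst := by
  refine ⟨hb, ?_⟩
  obtain ⟨B, rfl⟩ := hc.exists_eq_range ⟨Ω, hmem⟩
  obtain ⟨i₀, hi₀⟩ := hmem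
  intro p hp w hw K hA f hf
  have hsub : ∀ i, B i ⊆ Ω := fun i => (hb _ ⟨i, rfl⟩).2.1
  have hm : ∀ i, MeasurableSet (B i) := fun i => (hb _ ⟨i, rfl⟩).1
  have hnest : IsNested B := fun i j h => hn _ ⟨i, rfl⟩ _ ⟨j, rfl⟩ h
  have hfin : IsFiniteMeasure (volume.restrict Ω) :=
    ⟨by rw [Measure.restrict_apply_univ]; exact hΩ.lt_top⟩
  set μ := (volume : Measure (Cn n)).restrict Ω with hμ
  -- Averages do not see null sets, so passing to a measurable representative leaves the maximal
  -- function unchanged at every point.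
  set f' : Cn n → ℝ≥0∞ := fun z => ‖hf.mk f z‖ₑ with hf'
  have hf'm : Measurable f' := hf.measurable_mk.enorm
  have hff' : (fun z => ‖f z‖ₑ) =ᵐ[μ] f' := by
    filter_upwards [hf.ae_eq_mk] with z hz
    rw [hf', hz]
  have hmax : ∀ z, maximalOp (range B) f z = nestedMax μ B f' z := fun z => by
    rw [maximalOp_range, nestedMax]
    refine iSup_congr fun i => ?_
    rw [avg_congr (hsub i) hff', avg_eq_restrict (hsub i) (hm i)]
  have hmeas : Measurable (maximalOp (range B) f) := by
    rw [funext hmax]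
    exact measurable_nestedMax hm f'
  refine ⟨hmeas.aemeasurable, ?_⟩
  set w' := hw.mk w with hw'
  have hww' : w =ᵐ[μ] w' := hw.ae_eq_mk
  have key := hnest.lintegral_nestedMax_rpow_mul_le (μ := μ) hm
    (fun i => by
      rw [hμ, Measure.restrict_apply (hm i), inter_eq_self_of_subset_left (hsub i)]
      exact (hb _ ⟨i, rfl⟩).2.2.ne')
    (i₀ := i₀) (by rw [hi₀]; exact ae_restrict_mem (hi₀ ▸ hm i₀)) hw.measurable_mk hp (K := K)
    (fun i => by
      have h := hA _ ⟨i, rfl⟩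
      have e1 : (fun z => (w z : ℝ≥0∞)) =ᵐ[μ] fun z => (w' z : ℝ≥0∞) := by
        filter_upwards [hww'] with z hz
        rw [hz]
      have e2 : (fun z => (w z : ℝ≥0∞) ^ (1 - p.conjExponent)) =ᵐ[μ]
          fun z => (w' z : ℝ≥0∞) ^ (1 - p.conjExponent) := by
        filter_upwards [hww'] with z hz
        rw [hz]
      rwa [avg_congr (hsub i) e1, avg_congr (hsub i) e2, avg_eq_restrict (hsub i) (hm i),
        avg_eq_restrict (hsub i) (hm i)] at h) hf'm
  have e3 : ∫⁻ z, maximalOp (range B) f z ^ p * w z ∂μ =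
      ∫⁻ z, nestedMax μ B f' z ^ p * w' z ∂μ := by
    refine lintegral_congr_ae ?_
    filter_upwards [hww'] with z hz
    rw [hmax, hz]
  have e4 : ∫⁻ z, ‖f z‖ₑ ^ p * w z ∂μ = ∫⁻ z, f' z ^ p * w' z ∂μ := by
    refine lintegral_congr_ae ?_
    filter_upwards [hww', hff'] with z hz hz'
    rw [hz', hz]
  rw [e3, e4]
  exact key

lemma maximalOp_iUnion {ι : Type*} (𝓑 : ι → Set (Set (Cn n))) (f : Cn n → ℂ) (z : Cn n) :
    maximalOp (⋃ i, 𝓑 i) f z = ⨆ i, maximalOp (𝓑 i) f z := by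
  refine le_antisymm (iSup₂_le ?_) (iSup_le fun i => iSup₂_le ?_)
  · rintro B ⟨hB, hz⟩
    obtain ⟨i, hi⟩ := mem_iUnion.1 hB
    exact le_iSup_of_le i (le_iSup₂_of_le B ⟨hi, hz⟩ le_rfl)
  · rintro B ⟨hB, hz⟩
    exact le_iSup₂_of_le B ⟨mem_iUnion.2 ⟨i, hB⟩, hz⟩ le_rfl

/-- A finite union of Muckenhoupt bases is a Muckenhoupt basis. -/
theorem IsMuckenhouptBasis.iUnion {Ω : Set (Cn n)} {N : ℕ} {𝓑 : Fin N → Set (Set (Cn n))}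
    {C : ℝ → ℝ≥0 → ℝ≥0} (h : ∀ i, IsMuckenhouptBasis Ω (𝓑 i) C) :
    IsMuckenhouptBasis Ω (⋃ i, 𝓑 i) fun p K => N * C p K := by
  refine ⟨fun B hB => ?_, fun p hp w hw K hA f hf => ?_⟩
  · obtain ⟨i, hi⟩ := mem_iUnion.1 hB
    exact (h i).1 B hi
  have hi := fun i => (h i).2 p hp w hw K (fun B hB => hA B (mem_iUnion.2 ⟨i, hB⟩)) f hf
  have hp0 : 0 < p := by linarith
  have heq : maximalOp (⋃ i, 𝓑 i) f = fun z => ⨆ i, maximalOp (𝓑 i) f z :=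
    funext fun z => maximalOp_iUnion 𝓑 f z
  refine ⟨by rw [heq]; exact AEMeasurable.iSup fun i => (hi i).1, ?_⟩
  calc ∫⁻ z in Ω, maximalOp (⋃ i, 𝓑 i) f z ^ p * w z
      ≤ ∫⁻ z in Ω, ∑ i, maximalOp (𝓑 i) f z ^ p * w z := by
        refine lintegral_mono fun z => ?_
        rw [← Finset.sum_mul, heq]
        gcongr
        rw [← ENNReal.orderIsoRpow_apply p hp0, OrderIso.map_iSup]
        exact iSup_le fun i =>
          Finset.single_le_sum (f := fun i => maximalOp (𝓑 i) f z ^ p) (fun _ _ => zero_le)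
            (Finset.mem_univ i)
    _ = ∑ i, ∫⁻ z in Ω, maximalOp (𝓑 i) f z ^ p * w z :=
        lintegral_finsetSum' _ fun i _ => ((hi i).1.pow_const p).mul hw.coe_nnreal_ennreal
    _ ≤ ∑ _i : Fin N, C p K * ∫⁻ z in Ω, ‖f z‖ₑ ^ p * w z := Finset.sum_le_sum fun i _ => (hi i).2
    _ = _ := by simp [mul_assoc]

end Muckenhoupt

/-! ### Quasi-balls, dyadic cubes and the tents over them. -/

section Tents

variable {r : Cn n → ℝ} {e : BasisChoice n} {U V : Set (Cn n)} {t₀ : ℝ}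

lemma le_tau {ξ u : Cn n} {ε s : ℝ} (hs : 0 ≤ s)
    (h : ∀ l : ℂ, ‖l‖ ≤ s → |r (ξ + l • u) - r ξ| ≤ ε) : ENNReal.ofReal s ≤ tau r ξ u ε :=
  le_iSup₂_of_le s.toNNReal (fun l hl => h l (by rwa [Real.coe_toNNReal _ hs] at hl)) le_rfl

/-- If `r` oscillates by at most `ε` on the ball of radius `s`, then `τ ≥ s` in every unit
direction, while each coordinate of `z - ξ` is at most `s`. -/
lemma mem_polydisc {ξ z : Cn n} {ε s : ℝ} (hs : 0 ≤ s) (hz : dist z ξ ≤ s)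
    (h : ∀ y, dist y ξ ≤ s → |r y - r ξ| ≤ ε) : z ∈ polydisc r e ξ ε := by
  intro k
  refine le_trans ?_ (le_tau hs fun l hl => h _ ?_)
  · rw [← ofReal_norm]
    refine ENNReal.ofReal_le_ofReal ?_
    refine (PiLp.norm_apply_le _ k).trans ?_
    rwa [LinearIsometryEquiv.norm_map, ← dist_eq_norm]
  · rwa [dist_eq_norm, add_sub_cancel_left, norm_smul, (e ξ ε).norm_eq_one, mul_one]

/-- The quasi-metric balls contain Euclidean balls. -/
lemma exists_ball_subset_qball (h : Continuous r) (e : BasisChoice n) (c : Cn n) {ε : ℝ}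
    (hε : 0 < ε) : ∃ s > 0, bdry r ∩ Metric.ball c s ⊆ qball r e c ε := by
  obtain ⟨δ, hδ, hball⟩ := Metric.continuousAt_iff.1 h.continuousAt (ε / 4) (by positivity)
  -- Uniformity in `ξ` near `c` is needed because `ρ` involves polydiscs around both points; size `ε
  -- / 2` makes `ρ < ε` strict.
  have hclose : ∀ ξ, dist ξ c < δ / 2 → ∀ y, dist y ξ ≤ δ / 4 → |r y - r ξ| ≤ ε / 2 := by
    intro ξ hξ y hy
    have h1 := hball (x := y) (by linarith [dist_triangle y ξ c])
    have h2 := hball (x := ξ) (by linarith)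
    have h3 := dist_triangle_right (r y) (r ξ) (r c)
    rw [← Real.dist_eq]
    linarith
  refine ⟨δ / 4, by positivity, fun η hη => ⟨hη.1, ?_⟩⟩
  have hηc : dist η c < δ / 4 := hη.2
  have hbdd : BddBelow {ε : ℝ | 0 < ε ∧ η ∈ polydisc r e c ε ∧ c ∈ polydisc r e η ε} :=
    ⟨0, fun x hx => hx.1.le⟩
  refine (csInf_le hbdd ⟨half_pos hε, ?_, ?_⟩).trans_lt (half_lt_self hε)
  · exact mem_polydisc (by positivity) hηc.le (hclose c (by rw [dist_self]; positivity))
  · exact mem_polydisc (by positivity) (by rw [dist_comm]; exact hηc.le)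
      (hclose η (by linarith))

namespace DyadicGrid

variable (D : DyadicGrid r e)

lemma subset_bdry {k : ℕ} (hk : 1 ≤ k) {Q : Set (Cn n)} (hQ : Q ∈ D.cubes k) : Q ⊆ bdry r := by
  rw [← D.cover k hk]
  exact subset_sUnion_of_mem hQ

/-- A child of `P` lies in both cubes, and its parent is unique. -/
lemma eq_of_subset {k : ℕ} (hk : 1 ≤ k) {P Q : Set (Cn n)} (hP : P ∈ D.cubes k)
    (hQ : Q ∈ D.cubes k) (h : P ⊆ Q) : P = Q := by
  obtain ⟨P', hP', hsub⟩ := D.exists_child k hk P hP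
  exact (D.exists_unique_parent k hk P' hP').unique ⟨hP, hsub⟩ ⟨hQ, hsub.trans h⟩

lemma eq_of_inter_nonempty {k : ℕ} (hk : 1 ≤ k) {P Q : Set (Cn n)} (hP : P ∈ D.cubes k)
    (hQ : Q ∈ D.cubes k) (h : (P ∩ Q).Nonempty) : P = Q := by
  rcases D.nested k k hk hk P hP Q hQ h with h | h
  · exact D.eq_of_subset hk hP hQ h
  · exact (D.eq_of_subset hk hQ hP h).symm

lemma exists_ancestor {k l : ℕ} (hk : 1 ≤ k) (hkl : k ≤ l) {Q : Set (Cn n)}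
    (hQ : Q ∈ D.cubes l) : ∃ P ∈ D.cubes k, Q ⊆ P := by
  induction l, hkl using Nat.le_induction generalizing Q with
  | base => exact ⟨Q, hQ, subset_rfl⟩
  | succ l hkl ih =>
    obtain ⟨P, ⟨hP, hQP⟩, -⟩ := D.exists_unique_parent l (hk.trans hkl) Q hQ
    obtain ⟨P', hP', hPP'⟩ := ih hP
    exact ⟨P', hP', hQP.trans hPP'⟩

lemma subset_of_inter_nonempty {k l : ℕ} (hk : 1 ≤ k) (hkl : k ≤ l) {P Q : Set (Cn n)}
    (hP : P ∈ D.cubes k) (hQ : Q ∈ D.cubes l) (h : (P ∩ Q).Nonempty) : Q ⊆ P := by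
  obtain ⟨P', hP', hQP'⟩ := D.exists_ancestor hk hkl hQ
  rwa [D.eq_of_inter_nonempty hk hP hP' (h.mono (inter_subset_inter_right _ hQP'))]

lemma pow_δ_le {k l : ℕ} (hkl : k ≤ l) : D.δ ^ l ≤ D.δ ^ k :=
  pow_le_pow_of_le_one D.δ_pos.le D.δ_lt_one.le hkl

end DyadicGrid

lemma flowTent_subset_domain (Q : Set (Cn n)) (l : ℝ) : flowTent r U V Q l ⊆ domain r :=
  fun _ hz => hz.2.2.2

lemma flowTent_mono {P Q : Set (Cn n)} {l m : ℝ} (h : P ⊆ Q) (hl : l ≤ m) :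
    flowTent r U V P l ⊆ flowTent r U V Q m :=
  fun _ hz => ⟨hz.1, h hz.2.1, by linarith [hz.2.2.1], hz.2.2.2⟩

/-- The two maps may differ where no boundary point flows into `z`, but there neither value lies on
the boundary: the default value `z` has `r z < 0`. -/
lemma flowProj_mem_iff (h : Continuous r) {Ψ : Cn n → Cn n}
    (h1 : ∀ z, r z ∈ Ioo (-t₀) 0 → ∀ x, FlowsTo r U x z → x = Ψ z)
    (h2 : ∀ z, r z ∈ Ioo (-t₀) 0 → Ψ z ∈ bdry r → FlowsTo r U (Ψ z) z)
    {Q : Set (Cn n)} (hQ : Q ⊆ bdry r) {z : Cn n} (hz : r z ∈ Ioo (-t₀) 0) :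
    flowProj r U z ∈ Q ↔ Ψ z ∈ Q := by
  by_cases hex : ∃ x, FlowsTo r U x z
  · rw [flowProj, dif_pos hex, h1 z hz _ hex.choose_spec]
  · rw [flowProj, dif_neg hex]
    refine ⟨fun hzQ => ?_, fun hΨ => absurd ⟨_, h2 z hz (hQ hΨ)⟩ hex⟩
    exact absurd (apply_eq_zero_of_mem_bdry h (hQ hzQ)) hz.2.ne

/-- On the layer the tent is a preimage under a continuous map. It contains every point of Ω close
enough to `c`, since these project close to `c`; they form a non-empty open set. -/
lemma flowTent_measurable_and_pos (h : ContDiff ℝ ∞ r) (hbd : Bornology.IsBounded (domain r))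
    (hU : IsFlowNeighborhood r U V t₀) {Q : Set (Cn n)} (hQ : Q ⊆ bdry r) (hQm : MeasurableSet Q)
    {c : Cn n} (hc : c ∈ bdry r) {s : ℝ} (hs : 0 < s) (hcs : bdry r ∩ Metric.ball c s ⊆ Q)
    {l : ℝ} (hl : 0 < l) (hlt : l ≤ t₀) :
    MeasurableSet (flowTent r U V Q l) ∧ 0 < volume (flowTent r U V Q l) := by
  obtain ⟨Ψ, hΨc, h1, h2, h3⟩ := exists_flowInverse h hbd hU
  have hIoo : ∀ z, r z ∈ Ioo (-l) 0 → r z ∈ Ioo (-t₀) 0 := fun z hz =>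
    ⟨by linarith [hz.1], hz.2⟩
  have heq : flowTent r U V Q l = V ∩ ({z | r z ∈ Ioo (-l) 0} ∩ Ψ ⁻¹' Q) := by
    ext z
    constructor
    · rintro ⟨hV, hz, hr⟩
      exact ⟨hV, hr, (flowProj_mem_iff h.continuous h1 h2 hQ (hIoo z hr)).1 hz⟩
    · rintro ⟨hV, hr, hz⟩
      exact ⟨hV, (flowProj_mem_iff h.continuous h1 h2 hQ (hIoo z hr)).2 hz, hr⟩
  constructor
  · rw [heq]
    refine hU.isOpen_V.measurableSet.inter ?_
    have hS : MeasurableSet {z | r z ∈ Ioo (-l) 0} := h.continuous.measurable measurableSet_Ioo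
    have hΨm : Measurable ({z | r z ∈ Ioo (-l) 0}.domRestrict Ψ) :=
      (continuousOn_iff_continuous_domRestrict.1 (hΨc.mono fun z hz => hIoo z hz)).measurable
    have := hS.subtype_image (hΨm hQm)
    rwa [domRestrict_eq, preimage_comp, Subtype.image_preimage_coe] at this
  · obtain ⟨η, hη, hball⟩ := h3 c hc s hs
    set O := (Metric.ball c η ∩ V ∩ {z | -l < r z}) ∩ domain r with hO
    have hN : IsOpen (Metric.ball c η ∩ V ∩ {z | -l < r z}) :=
      (Metric.isOpen_ball.inter hU.isOpen_V).inter (isOpen_lt continuous_const h.continuous)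
    have hcN : c ∈ Metric.ball c η ∩ V ∩ {z | -l < r z} := by
      refine ⟨⟨Metric.mem_ball_self hη, hU.bdry_subset hc⟩, ?_⟩
      change -l < r c
      rw [apply_eq_zero_of_mem_bdry h.continuous hc]
      linarith
    have hOne : O.Nonempty := mem_closure_iff.1 (frontier_subset_closure hc) _ hN hcN
    refine ((hN.inter (isOpen_domain h.continuous)).measure_pos volume hOne).trans_le
      (measure_mono ?_)
    rintro z ⟨⟨⟨hzc, hzV⟩, hzl⟩, hz0⟩
    have hr : r z ∈ Ioo (-l) 0 := ⟨hzl, hz0⟩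
    rw [heq]
    exact ⟨hzV, hr, hcs (hball z hzc (hIoo z hr))⟩

variable {M : ℕ}

/-- The dyadic flow tents together with the domain form a Muckenhoupt basis. -/
theorem isMuckenhouptBasis_tents (hr : IsDefiningFunction r M)
    (hU : IsFlowNeighborhood r U V t₀) (D : DyadicGrid r e) {N₀ : ℕ}
    (hN : IsAdmissible r V t₀ D.δ N₀) :
    IsMuckenhouptBasis (domain r) (tents r U V D N₀) muckenhouptConst := by
  have hcont := hr.smooth.continuous
  have hopen := isOpen_domain hcont
  have htent : ∀ k, N₀ ≤ k → ∀ Q ∈ D.cubes k, MeasurableSet (flowTent r U V Q (D.δ ^ k)) ∧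
      0 < volume (flowTent r U V Q (D.δ ^ k)) := by
    intro k hk Q hQ
    have hk1 := hN.1.trans hk
    obtain ⟨s, hs, hsub⟩ := exists_ball_subset_qball hcont e (D.center k Q) (pow_pos D.δ_pos k)
    exact flowTent_measurable_and_pos hr.smooth hr.bounded hU (D.subset_bdry hk1 hQ)
      (D.measurable k hk1 Q hQ) (D.center_mem k hk1 Q hQ) hs
      (hsub.trans (D.sandwich k hk1 Q hQ).1) (pow_pos D.δ_pos k)
      ((D.pow_δ_le hk).trans hN.2.1.le)
  have hnest : ∀ k l, N₀ ≤ k → k ≤ l → ∀ P ∈ D.cubes k, ∀ Q ∈ D.cubes l,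
      (flowTent r U V P (D.δ ^ k) ∩ flowTent r U V Q (D.δ ^ l)).Nonempty → Q ⊆ P := by
    rintro k l hk hkl P hP Q hQ ⟨z, hz, hz'⟩
    exact D.subset_of_inter_nonempty (hN.1.trans hk) hkl hP hQ ⟨_, hz.2.1, hz'.2.1⟩
  -- Disjoint sets of positive volume in a σ-finite space are countably many; the tents of one
  -- generation are such sets.
  have hcount : ∀ k, N₀ ≤ k → (D.cubes k).Countable := by
    intro k hk
    have hpos := Measure.countable_meas_pos_of_disjoint_iUnion (μ := (volume : Measure (Cn n)))
      (As := fun Q : D.cubes k => flowTent r U V Q (D.δ ^ k)) (fun Q => (htent k hk Q Q.2).1)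
      (fun P Q hPQ => by
        rw [Function.onFun, Set.disjoint_iff_inter_eq_empty, ← Set.not_nonempty_iff_eq_empty]
        intro hne
        exact hPQ (Subtype.ext (D.eq_of_subset (hN.1.trans hk) Q.2 P.2
          (hnest k k hk le_rfl P P.2 Q Q.2 hne)).symm))
    have huniv : {Q : D.cubes k | 0 < volume (flowTent r U V Q (D.δ ^ k))} = univ :=
      eq_univ_of_forall fun Q => (htent k hk Q Q.2).2
    rw [huniv, countable_univ_iff] at hpos
    exact hpos
  refine isMuckenhouptBasis_of_nested hr.bounded.measure_lt_top.ne ?_ ?_ (Or.inl rfl) ?_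
  · rintro B (rfl | ⟨k, hk, Q, hQ, rfl⟩)
    · exact ⟨hopen.measurableSet, subset_rfl, hopen.measure_pos volume hr.nonempty⟩
    · exact ⟨(htent k hk Q hQ).1, flowTent_subset_domain Q _, (htent k hk Q hQ).2⟩
  · refine (countable_singleton _).union ?_
    refine (countable_iUnion fun k => countable_iUnion fun hk : N₀ ≤ k =>
      (hcount k hk).image fun Q => flowTent r U V Q (D.δ ^ k)).mono ?_
    rintro _ ⟨k, hk, Q, hQ, rfl⟩
    exact mem_iUnion₂.2 ⟨k, hk, Q, hQ, rfl⟩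
  · rintro A (rfl | ⟨k, hk, P, hP, rfl⟩) B (rfl | ⟨l, hl, Q, hQ, rfl⟩) hne
    · exact Or.inl subset_rfl
    · exact Or.inr (flowTent_subset_domain Q _)
    · exact Or.inl (flowTent_subset_domain P _)
    · rcases le_total k l with hkl | hkl
      · exact Or.inr (flowTent_mono (hnest k l hk hkl P hP Q hQ hne) (D.pow_δ_le hkl))
      · rw [inter_comm] at hne
        exact Or.inl (flowTent_mono (hnest l k hl hkl Q hQ P hP hne) (D.pow_δ_le hkl))

end Tents

end FlowTents

end

theorem proposition3p7 (n : ℕ) (hn : 1 < n) (r : FlowTents.Cn n → ℝ) (M : ℕ)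
    (hr : FlowTents.IsDefiningFunction r M) :
    (∃ C : ℝ → ℝ≥0 → ℝ≥0,
      ∀ (U V : Set (FlowTents.Cn n)) (t₀ : ℝ), FlowTents.IsFlowNeighborhood r U V t₀ →
      ∀ e : FlowTents.BasisChoice n, FlowTents.IsExtremalChoice r e →
      ∀ (D : FlowTents.DyadicGrid r e) (N₀ : ℕ), FlowTents.IsAdmissible r V t₀ D.δ N₀ →
        FlowTents.IsMuckenhouptBasis (FlowTents.domain r) (FlowTents.tents r U V D N₀) C) ∧
    (∀ K₀ : ℕ, ∃ C : ℝ → ℝ≥0 → ℝ≥0,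
      ∀ (U V : Set (FlowTents.Cn n)) (t₀ : ℝ), FlowTents.IsFlowNeighborhood r U V t₀ →
      ∀ e : FlowTents.BasisChoice n, FlowTents.IsExtremalChoice r e →
      ∀ (D : Fin K₀ → FlowTents.DyadicGrid r e) (N₀ : Fin K₀ → ℕ),
        (∀ i, FlowTents.IsAdmissible r V t₀ (D i).δ (N₀ i)) →
        FlowTents.IsMuckenhouptBasis (FlowTents.domain r)
          (⋃ i, FlowTents.tents r U V (D i) (N₀ i)) C) := by
  refine ⟨⟨FlowTents.muckenhouptConst, fun U V t₀ hU e _ D N₀ hN =>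
    FlowTents.isMuckenhouptBasis_tents hr hU D hN⟩, fun K₀ => ⟨fun p K =>
      K₀ * FlowTents.muckenhouptConst p K, fun U V t₀ hU e _ D N₀ hN =>
        FlowTents.IsMuckenhouptBasis.iUnion fun i =>
          FlowTents.isMuckenhouptBasis_tents hr hU (D i) (hN i)⟩⟩
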